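/- Let $d,n\ge 1$, let $\mathcal X\subset\mathbf R^n$ and $\mathcal Y\subset\mathbf R$ be arbitrary subsets, and let $\alpha\in\mathbf R$. Put $\gamma_*:=4\lceil d/2\rceil+6$. Assume that 1. $\sigma_*:\mathbf R^d\times\mathcal X\to\mathbf R$ belongs to $\mathcal C_b^\infty(\mathbf R^d\times\mathcal X)$, that is, $\sigma_*$ has (joint) derivatives of all orders on $\mathbf R^d\times\mathcal X$ (taken relative to this set), and $\sigma_*$ and all these derivatives are bounded; 2. $\pi$ is a probability measure on $\mathcal X\times\mathcal Y$ with $\int|y|^{16\gamma_*}\,\pi(\mathrm dx,\mathrm dy)<\infty$; 3. $\mu_0$ is a probability measure on $\mathbf R^d$ with $\int|w|^{8\gamma_*}\,\mu_0(\mathrm dw)<\infty$. Let $\mathcal P_1(\mathbf R^d)$ be the set of Borel probability measures on $\mathbf R^d$ with finite first moment, endowed with the Wasserstein distance $\mathsf W_1(\mu,\nu)=\inf\{\mathbf E|X-Y| : X\sim\mu,\ Y\sim\nu\}$, and write $\langle f,\mu\rangle=\int_{\mathbf R^d}f\,\mathrm d\mu$. Then there is exactly one $\bar\mu\in\mathcal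 C(\mathbf R_+,\mathcal P_1(\mathbf R^d))$ such that, for all $t\ge 0$ and all $f\in\mathcal C_b^\infty(\mathbf R^d)$ (smooth functions that are bounded together with all their derivatives), $$\langle f,\bar\mu_t\rangle=\langle f,\mu_0\rangle+\int_0^t\int_{\mathcal X\times\mathcal Y}\alpha\,\bigl(y-\langle\sigma_*(\cdot,x),\bar\mu_s\rangle\bigr)\,\langle\nabla f\cdot\nabla\sigma_*(\cdot,x),\bar\mu_s\rangle\,\pi(\mathrm dx,\mathrm dy)\,\mathrm ds ,$$ where $\nabla\sigma_*(\cdot,x)$ is the gradient in the variable $w\in\mathbf R^d$. -/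

import Mathlib

open MeasureTheory Filter Topology
open scoped ContDiff NNReal ENNReal

noncomputable section

namespace MeanField

/-- The space `ℝ^d` with its Euclidean norm. -/
abbrev E (d : ℕ) : Type := EuclideanSpace ℝ (Fin d)

/-- `f ∈ C_b^∞(ℝ^d)`: `f` is smooth, and `f` and all its derivatives are bounded. -/
def IsCbInfty {d : ℕ} (f : E d → ℝ) : Prop :=
  ContDiff ℝ ∞ f ∧ ∀ k : ℕ, ∃ C : ℝ, ∀ w, ‖iteratedFDeriv ℝ k f w‖ ≤ C

/-- `σ ∈ C_b^∞(ℝ^d × 𝒳)` for an arbitrary subset `𝒳 ⊆ ℝ^n`: on the set `ℝ^d × 𝒳` the function `σ`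
has derivatives `p · k` of all orders `k ≥ 0` (jointly in both variables, taken within that set),
and each of them is bounded. The function `F` is only a way to write `σ` as a function on
`ℝ^d × ℝ^n`; its values outside `ℝ^d × 𝒳` play no role. For `𝒳 = ℝ^n`, or `𝒳` open, this is the
usual space of smooth functions that are bounded together with all their derivatives. -/
def IsCbInftyOn {d n : ℕ} {𝒳 : Set (E n)} (σ : E d → 𝒳 → ℝ) : Prop :=
  ∃ (F : E d × E n → ℝ) (p : E d × E n → FormalMultilinearSeries ℝ (E d × E n) ℝ),
    (∀ (w : E d) (x : 𝒳), F (w, x) = σ w x) ∧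
    HasFTaylorSeriesUpToOn ∞ F p (Set.univ ×ˢ 𝒳) ∧
    ∀ k : ℕ, ∃ C : ℝ, ∀ z ∈ (Set.univ : Set (E d)) ×ˢ 𝒳, ‖p z k‖ ≤ C

/-- `P_1(ℝ^d)`: Borel probability measures on `ℝ^d` with a finite first moment. -/
abbrev P1 (d : ℕ) : Type :=
  {μ : ProbabilityMeasure (E d) // Integrable (fun w : E d => ‖w‖) (μ : Measure (E d))}

/-- The measure on `ℝ^d` underlying an element of `P_1(ℝ^d)`. -/
abbrev P1.toMeasure {d : ℕ} (μ : P1 d) : Measure (E d) := (μ.1 : Measure (E d))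

/-- The Wasserstein distance `W_1(μ, ν)`: the infimum of `𝐄|X - Y|` over all couplings `γ` (joint
laws of `(X, Y)`) of `μ` and `ν`. -/
def W1 {d : ℕ} (μ ν : P1 d) : ℝ≥0∞ :=
  ⨅ (γ : Measure (E d × E d)) (_ : γ.map Prod.fst = μ.toMeasure)
    (_ : γ.map Prod.snd = ν.toMeasure), ∫⁻ z, edist z.1 z.2 ∂γ

/-- `μ ∈ C(ℝ_+, P_1(ℝ^d))`: the curve `t ↦ μ_t` is continuous for the distance `W_1`. -/
def IsW1Continuous {d : ℕ} (μ : ℝ≥0 → P1 d) : Prop :=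
  ∀ t₀ : ℝ≥0, Tendsto (fun t => W1 (μ t) (μ t₀)) (𝓝 t₀) (𝓝 0)

/-- `μ` solves the limit equation: for every test function `f ∈ C_b^∞(ℝ^d)` and every `t ≥ 0`,
`⟨f, μ_t⟩ = ⟨f, μ₀⟩
  + ∫_0^t ∫_{𝒳 × 𝒴} α (y - ⟨σ(·, x), μ_s⟩) ⟨∇f · ∇σ(·, x), μ_s⟩ π(dx, dy) ds`. -/
def SolvesLimitEquation {d n : ℕ} {𝒳 : Set (E n)} {𝒴 : Set ℝ} (α : ℝ) (σ : E d → 𝒳 → ℝ)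
    (π : Measure (𝒳 × 𝒴)) (μ₀ : Measure (E d)) (μ : ℝ≥0 → P1 d) : Prop :=
  ∀ f : E d → ℝ, IsCbInfty f → ∀ t : ℝ≥0,
    ∫ w, f w ∂(μ t).toMeasure = ∫ w, f w ∂μ₀ +
      ∫ s in (0 : ℝ)..(t : ℝ), ∫ z : 𝒳 × 𝒴,
        α * ((z.2 : ℝ) - ∫ w, σ w z.1 ∂(μ s.toNNReal).toMeasure) *
          (∫ w, inner ℝ (gradient f w) (gradient (fun w' => σ w' z.1) w)
            ∂(μ s.toNNReal).toMeasure) ∂π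

/-- The exponent `γ_* = γ + 1` with `γ = 4 ⌈d/2⌉ + 5`. -/
def gammaStar (d : ℕ) : ℕ := 4 * ⌈(d : ℝ) / 2⌉₊ + 5 + 1

end MeanField

end

/-! By Fubini, the equation is the weak form of the continuity equation ∂ₜμ + div(μ b(μ)) = 0 with
velocity b(ρ) = ∇Φ_ρ, where Φ_ρ(w) = ∫ α (y - ⟨σ(·, x), ρ⟩) σ(w, x) π(dx, dy)
(`SmoothKernel.solvesLimitEquation_iff`). Since σ and its derivatives are bounded and y is
π-integrable, b is bounded and smooth in w, uniformly in ρ, and Lipschitz in ρ for the weak distance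
tested on `DerivBound` functions (`SmoothKernel.exists_regularDrift`). Everything else uses only
these properties, collected in `RegularDrift`.

Existence goes by characteristics: μ_t is the law of w + Z_t(w) for w of law μ₀, where Z solves an
autonomous ODE in the Banach space of bounded continuous maps. Its vector field is bounded and
globally Lipschitz, so Z is global in time, and the chain rule gives the equation
(`RegularDrift.exists_weakSolution`).

For uniqueness, a direct Gronwall estimate loses a derivative, because ⟨f, μ⟩ evolves through ∇f ·
b. An Euler step does not: up to O(h²), ⟨f, μ_{s+h}⟩ equals ⟨f ∘ (id + h b(μ_s)), μ_s⟩, and this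
composition only multiplies the constant of the test function by 1 + O(h)
(`abs_integral_sub_euler_le`, `derivBound_euler`). Over N steps of length t/N the errors add up to
O(1/N), so two solutions agree against all bounded smooth functions. These include the cosines and
sines that give the characteristic function. -/

namespace MeanField

/-! ### Calculus of bounded smooth functions -/

section Calculus

variable {F G H : Type*} [NormedAddCommGroup F] [NormedSpace ℝ F] [NormedAddCommGroup G]
  [NormedSpace ℝ G] [NormedAddCommGroup H] [NormedSpace ℝ H]

/-- Smooth functions that are bounded together with all their derivatives. -/
def BddSmooth (f : F → G) : Prop :=
  ContDiff ℝ ∞ f ∧ ∀ k : ℕ, ∃ C : ℝ, ∀ w, ‖iteratedFDeriv ℝ k f w‖ ≤ C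

theorem BddSmooth.differentiable {f : F → G} (hf : BddSmooth f) : Differentiable ℝ f :=
  hf.1.differentiable (by simp)

theorem BddSmooth.const (c : G) : BddSmooth (fun _ : F => c) := by
  refine ⟨contDiff_const, fun k => ?_⟩
  rcases Nat.eq_zero_or_pos k with rfl | hk
  · exact ⟨‖c‖, fun w => by simp⟩
  · exact ⟨0, fun w => by simp [iteratedFDeriv_const_of_ne hk.ne']⟩

theorem BddSmooth.add {f g : F → G} (hf : BddSmooth f) (hg : BddSmooth g) :
    BddSmooth (fun w => f w + g w) := by
  refine ⟨hf.1.add hg.1, fun k => ?_⟩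
  obtain ⟨C, hC⟩ := hf.2 k
  obtain ⟨D, hD⟩ := hg.2 k
  refine ⟨C + D, fun w => ?_⟩
  have h : iteratedFDeriv ℝ k (fun w => f w + g w) w =
      iteratedFDeriv ℝ k f w + iteratedFDeriv ℝ k g w :=
    iteratedFDeriv_add_apply (hf.1.of_le (mod_cast le_top)).contDiffAt
      (hg.1.of_le (mod_cast le_top)).contDiffAt
  rw [h]
  exact (norm_add_le _ _).trans (add_le_add (hC w) (hD w))

theorem BddSmooth.clm_comp (L : G →L[ℝ] H) {f : F → G} (hf : BddSmooth f) :
    BddSmooth (fun w => L (f w)) := by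
  refine ⟨L.contDiff.comp hf.1, fun k => ?_⟩
  obtain ⟨C, hC⟩ := hf.2 k
  exact ⟨‖L‖ * C, fun w => (L.norm_iteratedFDeriv_comp_left hf.1.contDiffAt
    (mod_cast le_top)).trans (mul_le_mul_of_nonneg_left (hC w) (norm_nonneg _))⟩

theorem BddSmooth.fderiv_right {f : F → G} (hf : BddSmooth f) : BddSmooth (fderiv ℝ f) := by
  refine ⟨hf.1.fderiv_right (by simp), fun k => ?_⟩
  simpa only [norm_iteratedFDeriv_fderiv] using hf.2 (k + 1)

theorem BddSmooth.bilinear (B : F →L[ℝ] G →L[ℝ] H) {D : Type*} [NormedAddCommGroup D]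
    [NormedSpace ℝ D] {f : D → F} {g : D → G} (hf : BddSmooth f) (hg : BddSmooth g) :
    BddSmooth (fun w => B (f w) (g w)) := by
  refine ⟨B.isBoundedBilinearMap.contDiff.comp (hf.1.prodMk hg.1), fun k => ?_⟩
  choose C hC using hf.2
  choose C' hC' using hg.2
  refine ⟨‖B‖ * ∑ i ∈ Finset.range (k + 1), (k.choose i : ℝ) * C i * C' (k - i), fun w => ?_⟩
  refine (B.norm_iteratedFDeriv_le_of_bilinear hf.1 hg.1 w (mod_cast le_top)).trans ?_
  have hC0 : ∀ i, 0 ≤ C i := fun i => (norm_nonneg _).trans (hC i w)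
  gcongr with i hi
  · exact mul_nonneg (Nat.cast_nonneg _) (hC0 i)
  · exact hC i w
  · exact hC' _ w

/-- A bounded smooth function of a perturbation of the identity by a bounded smooth function. -/
theorem BddSmooth.comp_add_smul {f : F → G} (hf : BddSmooth f) {v : F → F} (hv : BddSmooth v)
    (h : ℝ) : BddSmooth (fun w => f (w + h • v w)) := by
  have hS : ContDiff ℝ ∞ (fun w => w + h • v w) := contDiff_id.add (hv.1.const_smul h)
  have hS' : fderiv ℝ (fun w => w + h • v w) =
      fun w => ContinuousLinearMap.id ℝ F + (h • ContinuousLinearMap.id ℝ (F →L[ℝ] F))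
        (fderiv ℝ v w) := by
    funext w
    exact ((hasFDerivAt_id w).add ((hv.differentiable w).hasFDerivAt.const_smul h)).fderiv
  have hSb : BddSmooth (fderiv ℝ (fun w => w + h • v w)) := by
    rw [hS']
    exact (BddSmooth.const _).add (hv.fderiv_right.clm_comp _)
  refine ⟨hf.1.comp hS, fun k => ?_⟩
  choose C hC using hf.2
  choose D hD using hSb.2
  -- The Faà di Bruno bound asks for ‖Dⁱ(w + h v(w))‖ ≤ D₀ ^ i, for 1 ≤ i ≤ k only, so the unbounded
  -- identity part is harmless. The summand 1 in D₀ gives D₀ ≤ D₀ ^ i.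
  set C₀ := ∑ i ∈ Finset.range (k + 1), |C i|
  set D₀ := 1 + ∑ i ∈ Finset.range (k + 1), |D i|
  have hD₀ : 1 ≤ D₀ := le_add_of_nonneg_right (Finset.sum_nonneg fun _ _ => abs_nonneg _)
  refine ⟨k.factorial * C₀ * D₀ ^ k, fun w => ?_⟩
  refine norm_iteratedFDeriv_comp_le hf.1 hS (mod_cast le_top) w (fun i hi => ?_)
    (fun i hi hik => ?_)
  · exact ((hC i _).trans (le_abs_self _)).trans
      (Finset.single_le_sum (f := fun i => |C i|) (fun _ _ => abs_nonneg _)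
        (Finset.mem_range.2 (by omega)))
  · obtain ⟨j, rfl⟩ : ∃ j, i = j + 1 := ⟨i - 1, by omega⟩
    rw [← norm_iteratedFDeriv_fderiv]
    have h1 : |D j| ≤ ∑ i ∈ Finset.range (k + 1), |D i| :=
      Finset.single_le_sum (f := fun i => |D i|) (fun _ _ => abs_nonneg _)
        (Finset.mem_range.2 (by omega))
    calc _ ≤ D j := hD j w
      _ ≤ D₀ := by linarith [le_abs_self (D j)]
      _ ≤ D₀ ^ (j + 1) := le_self_pow₀ hD₀ (by omega)

theorem norm_fderiv_sub_le_of_norm_iteratedFDeriv_two_le {f : F → G} (hf : ContDiff ℝ ∞ f) {C : ℝ}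
    (hC : ∀ w, ‖iteratedFDeriv ℝ 2 f w‖ ≤ C) (u w : F) :
    ‖fderiv ℝ f u - fderiv ℝ f w‖ ≤ C * ‖u - w‖ := by
  refine convex_univ.norm_image_sub_le_of_norm_fderiv_le (𝕜 := ℝ) (fun x _ => ?_) (fun x _ => ?_)
    (Set.mem_univ w) (Set.mem_univ u)
  · exact (hf.fderiv_right (m := ∞) (by simp)).differentiable (by simp) x
  · rw [← norm_iteratedFDeriv_one, norm_iteratedFDeriv_fderiv]
    exact hC x

/-- Meant for the cosine and sine of a linear form, the test functions that detect the
characteristic function. -/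
theorem BddSmooth.comp_clm_of_deriv_bound {g : ℝ → ℝ} (hg : ContDiff ℝ ∞ g)
    (hb : ∀ k x, |iteratedDeriv k g x| ≤ 1) (L : F →L[ℝ] ℝ) : BddSmooth (fun w => g (L w)) := by
  refine ⟨hg.comp L.contDiff, fun k => ⟨‖L‖ ^ k, fun w => ?_⟩⟩
  have h : iteratedFDeriv ℝ k (fun w => g (L w)) w =
      (iteratedFDeriv ℝ k g (L w)).compContinuousLinearMap fun _ => L :=
    L.iteratedFDeriv_comp_right hg w (mod_cast le_top)
  rw [h]
  refine (ContinuousMultilinearMap.norm_compContinuousLinearMap_le _ _).trans ?_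
  rw [norm_iteratedFDeriv_eq_norm_iteratedDeriv, Finset.prod_const, Finset.card_univ,
    Fintype.card_fin]
  exact mul_le_of_le_one_left (by positivity) (hb k _)

end Calculus

/-! ### Gradients through the Riesz isometry -/

section Gradient

variable {F : Type*} [NormedAddCommGroup F] [InnerProductSpace ℝ F] [CompleteSpace F]

/-- The inverse of the Riesz isomorphism of a real Hilbert space, as a continuous linear map. -/
noncomputable def rieszSymm (F : Type*) [NormedAddCommGroup F] [InnerProductSpace ℝ F]
    [CompleteSpace F] : (F →L[ℝ] ℝ) →L[ℝ] F :=
  LinearMap.mkContinuous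
    { toFun := (InnerProductSpace.toDual ℝ F).symm
      map_add' := fun x y => map_add _ x y
      map_smul' := fun c x => by simp } 1 (fun x => by simp)

theorem norm_rieszSymm_le : ‖rieszSymm F‖ ≤ 1 := LinearMap.mkContinuous_norm_le _ zero_le_one _

theorem norm_gradient (f : F → ℝ) (w : F) : ‖gradient f w‖ = ‖fderiv ℝ f w‖ := by
  simp [gradient]

theorem inner_gradient_left (f : F → ℝ) (w v : F) : inner ℝ (gradient f w) v = fderiv ℝ f w v := by
  simp [gradient]

theorem inner_gradient_right (f : F → ℝ) (w v : F) :
    inner ℝ v (gradient f w) = fderiv ℝ f w v := by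
  rw [real_inner_comm, inner_gradient_left]

theorem norm_gradient_sub (f g : F → ℝ) (u w : F) :
    ‖gradient f u - gradient g w‖ = ‖fderiv ℝ f u - fderiv ℝ g w‖ := by
  rw [gradient, gradient, ← map_sub, LinearIsometryEquiv.norm_map]

theorem BddSmooth.gradient_right {f : F → ℝ} (hf : BddSmooth f) : BddSmooth (gradient f) :=
  hf.fderiv_right.clm_comp (rieszSymm F)

theorem norm_iteratedFDeriv_gradient_le {f : F → ℝ} (hf : ContDiff ℝ ∞ f) (k : ℕ) (w : F) :
    ‖iteratedFDeriv ℝ k (gradient f) w‖ ≤ ‖iteratedFDeriv ℝ (k + 1) f w‖ := by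
  rw [← norm_iteratedFDeriv_fderiv]
  have h : ContDiff ℝ ∞ (fderiv ℝ f) := hf.fderiv_right (by simp)
  refine ((rieszSymm F).norm_iteratedFDeriv_comp_left h.contDiffAt (n := k)
    (mod_cast le_top)).trans ?_
  exact mul_le_of_le_one_left (norm_nonneg _) norm_rieszSymm_le

end Gradient

theorem BddSmooth.real_inner {F D : Type*} [NormedAddCommGroup F] [InnerProductSpace ℝ F] [NormedAddCommGroup D] [NormedSpace ℝ D] {f g : D → F}
    (hf : BddSmooth f) (hg : BddSmooth g) : BddSmooth (fun w => inner ℝ (f w) (g w)) :=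
  BddSmooth.bilinear (innerSL ℝ) hf hg

/-! ### Test functions with bounded Lipschitz gradient -/

section DerivBound

variable {d : ℕ}

/-- Test functions whose gradient is bounded by `q` and Lipschitz with constant `q`. -/
structure DerivBound (q : ℝ) (f : E d → ℝ) : Prop where
  smooth : BddSmooth f
  norm_le : ∀ w, ‖fderiv ℝ f w‖ ≤ q
  sub_le : ∀ u w, ‖fderiv ℝ f u - fderiv ℝ f w‖ ≤ q * ‖u - w‖

theorem DerivBound.of_iteratedFDeriv {q : ℝ} {f : E d → ℝ} (hf : BddSmooth f)
    (h1 : ∀ w, ‖iteratedFDeriv ℝ 1 f w‖ ≤ q) (h2 : ∀ w, ‖iteratedFDeriv ℝ 2 f w‖ ≤ q) :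
    DerivBound q f :=
  ⟨hf, fun w => by simpa only [norm_iteratedFDeriv_one] using h1 w,
    norm_fderiv_sub_le_of_norm_iteratedFDeriv_two_le hf.1 h2⟩

theorem BddSmooth.exists_derivBound {f : E d → ℝ} (hf : BddSmooth f) : ∃ q, DerivBound q f := by
  obtain ⟨C, hC⟩ := hf.2 1
  obtain ⟨D, hD⟩ := hf.2 2
  exact ⟨max C D, .of_iteratedFDeriv hf (fun w => (hC w).trans (le_max_left _ _))
    (fun w => (hD w).trans (le_max_right _ _))⟩

theorem DerivBound.nonneg {q : ℝ} {f : E d → ℝ} (hf : DerivBound q f) : 0 ≤ q :=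
  (norm_nonneg _).trans (hf.norm_le 0)

theorem abs_sub_le_of_norm_fderiv_le {f : E d → ℝ} (hf : BddSmooth f) {q : ℝ}
    (hq : ∀ w, ‖fderiv ℝ f w‖ ≤ q) (u w : E d) : |f u - f w| ≤ q * ‖u - w‖ :=
  convex_univ.norm_image_sub_le_of_norm_fderiv_le (𝕜 := ℝ) (fun x _ => hf.differentiable x)
    (fun x _ => hq x) (Set.mem_univ w) (Set.mem_univ u)

theorem DerivBound.abs_sub_le {q : ℝ} {f : E d → ℝ} (hf : DerivBound q f) (u w : E d) :
    |f u - f w| ≤ q * ‖u - w‖ :=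
  abs_sub_le_of_norm_fderiv_le hf.smooth hf.norm_le u w

/-- First order Taylor expansion. -/
theorem DerivBound.abs_taylor_le {q : ℝ} {f : E d → ℝ} (hf : DerivBound q f) (w v : E d) :
    |f (w + v) - f w - inner ℝ (gradient f w) v| ≤ q * ‖v‖ ^ 2 := by
  -- Mean value inequality for f minus its linearisation at w: on the ball of radius ‖v‖ the
  -- derivative moves by at most q‖v‖.
  have h := (convex_closedBall w ‖v‖).norm_image_sub_le_of_norm_hasFDerivWithin_le'
    (f := f) (f' := fderiv ℝ f) (φ := fderiv ℝ f w) (C := q * ‖v‖) (x := w) (y := w + v)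
    (fun x _ => (hf.smooth.differentiable x).hasFDerivAt.hasFDerivWithinAt)
    (fun x hx => (hf.sub_le x w).trans (mul_le_mul_of_nonneg_left
      (by simpa [dist_eq_norm] using hx) hf.nonneg))
    (Metric.mem_closedBall_self (norm_nonneg _)) (by simp [dist_eq_norm])
  rw [add_sub_cancel_left, Real.norm_eq_abs, ← inner_gradient_left] at h
  exact h.trans_eq (by ring)

theorem BddSmooth.integrable {f : E d → ℝ} (hf : BddSmooth f) (ρ : Measure (E d))
    [IsFiniteMeasure ρ] : Integrable f ρ := by
  obtain ⟨C, hC⟩ := hf.2 0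
  exact Integrable.of_bound hf.1.continuous.aestronglyMeasurable C
    (ae_of_all _ fun w => by simpa using hC w)

/-- A probability measure is determined by its integrals of bounded smooth functions. -/
theorem measure_ext_of_bddSmooth {ρ ρ' : Measure (E d)} [IsProbabilityMeasure ρ]
    [IsProbabilityMeasure ρ'] (h : ∀ f : E d → ℝ, BddSmooth f → ∫ w, f w ∂ρ = ∫ w, f w ∂ρ') :
    ρ = ρ' := by
  refine Measure.ext_of_charFun (funext fun ξ => ?_)
  have hc : BddSmooth (fun w : E d => Real.cos (innerSL ℝ ξ w)) :=
    .comp_clm_of_deriv_bound Real.contDiff_cos Real.abs_iteratedDeriv_cos_le_one _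
  have hs : BddSmooth (fun w : E d => Real.sin (innerSL ℝ ξ w)) :=
    .comp_clm_of_deriv_bound Real.contDiff_sin Real.abs_iteratedDeriv_sin_le_one _
  have key : ∀ (τ : Measure (E d)) [IsProbabilityMeasure τ], charFun τ ξ =
      ((∫ w, Real.cos (innerSL ℝ ξ w) ∂τ : ℝ) : ℂ) +
        ((∫ w, Real.sin (innerSL ℝ ξ w) ∂τ : ℝ) : ℂ) * Complex.I := by
    intro τ _
    rw [charFun_apply, ← integral_complex_ofReal, ← integral_complex_ofReal,
      ← integral_mul_const, ← integral_add (hc.integrable τ).ofReal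
        ((hs.integrable τ).ofReal.mul_const _)]
    refine integral_congr_ae (ae_of_all _ fun w => ?_)
    simp only [innerSL_apply_apply, real_inner_comm, Complex.exp_mul_I, Complex.ofReal_cos,
      Complex.ofReal_sin]
  rw [key ρ, key ρ', h _ hc, h _ hs]

end DerivBound

/-! ### Regular drifts and smooth kernels -/

section Drift

variable {d : ℕ}

/-- A measure dependent velocity field `b ρ` on `ℝ^d` that is bounded and smooth in space, with a
constant `M` that controls its first two derivatives and its dependence on `ρ`. -/
structure RegularDrift (b : Measure (E d) → E d → E d) (M : ℝ) : Prop where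
  nonneg : 0 ≤ M
  smooth : ∀ (ρ : Measure (E d)) [IsProbabilityMeasure ρ], BddSmooth (b ρ)
  norm_le : ∀ (ρ : Measure (E d)) [IsProbabilityMeasure ρ] (w : E d), ‖b ρ w‖ ≤ M
  norm_fderiv_le : ∀ (ρ : Measure (E d)) [IsProbabilityMeasure ρ] (w : E d),
    ‖fderiv ℝ (b ρ) w‖ ≤ M
  norm_fderiv_sub_le : ∀ (ρ : Measure (E d)) [IsProbabilityMeasure ρ] (u w : E d),
    ‖fderiv ℝ (b ρ) u - fderiv ℝ (b ρ) w‖ ≤ M * ‖u - w‖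
  -- Here e is any bound on the weak distance between ρ and ρ' tested on `DerivBound` functions, so
  -- no supremum has to be formed.
  norm_sub_le : ∀ (ρ ρ' : Measure (E d)) [IsProbabilityMeasure ρ] [IsProbabilityMeasure ρ'] (e : ℝ),
    (∀ (q : ℝ) (f : E d → ℝ), DerivBound q f → |∫ w, f w ∂ρ - ∫ w, f w ∂ρ'| ≤ q * e) →
    ∀ w, ‖b ρ w - b ρ' w‖ ≤ M * e

end Drift

/-- A family of functions on `ℝ^d`, smooth with uniform bounds on all derivatives, that depends
continuously on a parameter together with all its derivatives. -/
structure SmoothKernel {d : ℕ} {X : Type*} [TopologicalSpace X] (σ : E d → X → ℝ) : Prop where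
  contDiff : ∀ x, ContDiff ℝ ∞ (fun w => σ w x)
  continuous_iteratedFDeriv : ∀ k : ℕ,
    Continuous (fun p : E d × X => iteratedFDeriv ℝ k (fun w => σ w p.2) p.1)
  norm_le : ∀ k : ℕ, ∃ C : ℝ, ∀ w x, ‖iteratedFDeriv ℝ k (fun w => σ w x) w‖ ≤ C

/-- Derivatives within ℝ^d × 𝒳 need not be unique for arbitrary 𝒳. Pulled back along the affine map
w ↦ (w, x), however, the set becomes all of ℝ^d, so the pulled-back series is the true Taylor series
of σ(·, x). Continuity and bounds are then inherited from p. -/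
theorem IsCbInftyOn.smoothKernel {d n : ℕ} {𝒳 : Set (E n)} {σ : E d → 𝒳 → ℝ}
    (hσ : IsCbInftyOn σ) : SmoothKernel σ := by
  obtain ⟨F, p, hF, hp, hb⟩ := hσ
  let ι : 𝒳 → (E d →ᴬ[ℝ] E d × E n) := fun x =>
    (ContinuousLinearMap.inl ℝ (E d) (E n)).toContinuousAffineMap +
      ContinuousAffineMap.const ℝ (E d) ((0, (x : E n)) : E d × E n)
  have hι : ∀ (x : 𝒳) (w : E d), ι x w = (w, (x : E n)) := fun x w => by simp [ι]
  have hc : ∀ x, (ι x).contLinear = ContinuousLinearMap.inl ℝ (E d) (E n) := fun x => by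
    ext v <;> simp [ι]
  have hT : ∀ x : 𝒳, HasFTaylorSeriesUpTo ∞ (fun w => σ w x) (fun w k =>
      (p (w, (x : E n)) k).compContinuousLinearMap
        fun _ => ContinuousLinearMap.inl ℝ (E d) (E n)) := by
    intro x
    have h := hp.comp_continuousAffineMap (ι x)
    have hpre : (ι x) ⁻¹' (Set.univ ×ˢ 𝒳) = Set.univ := by
      ext w
      simp [hι]
    rw [hpre] at h
    have hf : F ∘ ι x = fun w => σ w x := by
      funext w
      simp [hι, hF]
    have hq : (fun w k => (p (ι x w) k).compContinuousLinearMap fun _ => (ι x).contLinear) =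
        fun w k => (p (w, (x : E n)) k).compContinuousLinearMap
          fun _ => ContinuousLinearMap.inl ℝ (E d) (E n) := by
      funext w k
      rw [hι, hc]
    rw [← hf]
    exact hasFTaylorSeriesUpToOn_univ_iff.1
      (Eq.mp (congrArg (fun q => HasFTaylorSeriesUpToOn ∞ (F ∘ ι x) q Set.univ) hq) h)
  have heq : ∀ (x : 𝒳) (w : E d) (k : ℕ), iteratedFDeriv ℝ k (fun w => σ w x) w =
      (p (w, (x : E n)) k).compContinuousLinearMap
        fun _ => ContinuousLinearMap.inl ℝ (E d) (E n) :=
    fun x w k => ((hT x).eq_iteratedFDeriv (m := k) (mod_cast le_top) w).symm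
  refine ⟨fun x => (hT x).contDiff, fun k => ?_, fun k => ?_⟩
  · simp only [heq]
    have h1 : Continuous fun z : E d × 𝒳 => p (z.1, (z.2 : E n)) k :=
      (hp.cont k (mod_cast le_top)).comp_continuous (by fun_prop) (fun z => ⟨trivial, z.2.2⟩)
    exact (ContinuousMultilinearMap.compContinuousLinearMapL (F := ℝ)
      (fun _ : Fin k => ContinuousLinearMap.inl ℝ (E d) (E n))).continuous.comp h1
  · obtain ⟨C, hC⟩ := hb k
    refine ⟨C, fun w x => ?_⟩
    rw [heq]
    refine (ContinuousMultilinearMap.norm_compContinuousLinearMap_le _ _).trans ?_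
    refine (mul_le_of_le_one_right (norm_nonneg _) ?_).trans (hC _ ⟨trivial, x.2⟩)
    exact Finset.prod_le_one (fun _ _ => norm_nonneg _)
      (fun _ _ => ContinuousLinearMap.norm_inl_le_one ℝ (E d) (E n))

section Kernel

variable {d : ℕ} {X : Type*} [TopologicalSpace X] {σ : E d → X → ℝ}

theorem SmoothKernel.continuous (hσ : SmoothKernel σ) :
    Continuous (fun p : E d × X => σ p.1 p.2) := by
  have h := hσ.continuous_iteratedFDeriv 0
  exact (ContinuousMultilinearMap.apply ℝ (fun _ : Fin 0 => E d) ℝ 0).continuous.comp h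

theorem SmoothKernel.continuous_fderiv (hσ : SmoothKernel σ) :
    Continuous (fun p : E d × X => fderiv ℝ (fun w => σ w p.2) p.1) := by
  have h := hσ.continuous_iteratedFDeriv 1
  have h2 := (continuousMultilinearCurryFin1 ℝ (E d) ℝ).continuous.comp h
  refine h2.congr fun p => ?_
  ext v
  simp

theorem SmoothKernel.continuous_gradient (hσ : SmoothKernel σ) :
    Continuous (fun p : E d × X => gradient (fun w => σ w p.2) p.1) :=
  (rieszSymm (E d)).continuous.comp hσ.continuous_fderiv

theorem SmoothKernel.bddSmooth (hσ : SmoothKernel σ) (x : X) : BddSmooth (fun w => σ w x) :=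
  ⟨hσ.contDiff x, fun k => (hσ.norm_le k).imp fun _ hC w => hC w x⟩

end Kernel

/-! ### Averages of a kernel over the data -/

section Potential

variable {d : ℕ} {X Y : Type*} [TopologicalSpace X] [SecondCountableTopology X] [MeasurableSpace X]
  [OpensMeasurableSpace X] [MeasurableSpace Y] {σ : E d → X → ℝ} {π : Measure (X × Y)}
  {c : X × Y → ℝ}

/-- The weighted average `w ↦ ∫ c(x, y) σ(w, x) π(dx, dy)` of a kernel. -/
noncomputable def potential (π : Measure (X × Y)) (σ : E d → X → ℝ) (c : X × Y → ℝ) (w : E d) : ℝ :=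
  ∫ z, c z * σ w z.1 ∂π

theorem SmoothKernel.aestronglyMeasurable_smul (hσ : SmoothKernel σ) (hc : Integrable c π) (k : ℕ)
    (w : E d) :
    AEStronglyMeasurable (fun z => c z • iteratedFDeriv ℝ k (fun w => σ w z.1) w) π := by
  have h : Continuous fun x : X => iteratedFDeriv ℝ k (fun w => σ w x) w :=
    (hσ.continuous_iteratedFDeriv k).comp (by fun_prop : Continuous fun x : X => (w, x))
  exact hc.aestronglyMeasurable.smul
    (h.stronglyMeasurable.comp_measurable measurable_fst).aestronglyMeasurable

theorem SmoothKernel.integrable_smul (hσ : SmoothKernel σ) (hc : Integrable c π) (k : ℕ)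
    (w : E d) : Integrable (fun z => c z • iteratedFDeriv ℝ k (fun w => σ w z.1) w) π := by
  obtain ⟨C, hC⟩ := hσ.norm_le k
  refine Integrable.mono' (hc.norm.mul_const C) (hσ.aestronglyMeasurable_smul hc k w)
    (ae_of_all _ fun z => ?_)
  rw [norm_smul]
  exact mul_le_mul_of_nonneg_left (hC _ _) (norm_nonneg _)

/-- Differentiation under the integral at every order: the derivative of order k + 1 of the
integrand is dominated by a constant times |c|, which is integrable. -/
theorem SmoothKernel.hasFTaylorSeriesUpTo_potential (hσ : SmoothKernel σ) (hc : Integrable c π) :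
    HasFTaylorSeriesUpTo ∞ (potential π σ c)
      (fun w k => ∫ z, c z • iteratedFDeriv ℝ k (fun w => σ w z.1) w ∂π) := by
  have hdiff : ∀ (k : ℕ) (w : E d),
      HasFDerivAt (fun w => ∫ z, c z • iteratedFDeriv ℝ k (fun w => σ w z.1) w ∂π)
        (∫ z, c z • iteratedFDeriv ℝ (k + 1) (fun w => σ w z.1) w ∂π).curryLeft w := by
    intro k w
    obtain ⟨C, hC⟩ := hσ.norm_le (k + 1)
    let L : (E d [×(k + 1)]→L[ℝ] ℝ) →L[ℝ] E d →L[ℝ] (E d [×k]→L[ℝ] ℝ) :=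
      (continuousMultilinearCurryLeftEquiv ℝ (fun _ : Fin (k + 1) => E d)
        ℝ).toContinuousLinearEquiv.toContinuousLinearMap
    have hL : ∀ (a : ℝ) (T : E d [×(k + 1)]→L[ℝ] ℝ), L (a • T) = a • T.curryLeft :=
      fun a T => map_smul L a T
    have hcurry : (∫ z, c z • iteratedFDeriv ℝ (k + 1) (fun w => σ w z.1) w ∂π).curryLeft =
        ∫ z, c z • (iteratedFDeriv ℝ (k + 1) (fun w => σ w z.1) w).curryLeft ∂π := by
      have h := ContinuousLinearMap.integral_comp_comm (𝕜 := ℝ)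
        (Fₗ := E d →L[ℝ] (E d [×k]→L[ℝ] ℝ)) L (hσ.integrable_smul hc (k + 1) w)
      simp only [hL] at h
      exact h.symm
    rw [hcurry]
    refine hasFDerivAt_integral_of_dominated_of_fderiv_le (s := Set.univ)
      (bound := fun z => ‖c z‖ * C)
      (F' := fun w z => c z • (iteratedFDeriv ℝ (k + 1) (fun w => σ w z.1) w).curryLeft) univ_mem
      (Eventually.of_forall fun w => hσ.aestronglyMeasurable_smul hc k w)
      (hσ.integrable_smul hc k w) ?_ ?_ (hc.norm.mul_const C) ?_
    · simpa only [hL] using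
        L.continuous.comp_aestronglyMeasurable (hσ.aestronglyMeasurable_smul hc (k + 1) w)
    · refine ae_of_all _ fun z u _ => ?_
      rw [norm_smul, ContinuousMultilinearMap.curryLeft_norm]
      exact mul_le_mul_of_nonneg_left (hC _ _) (norm_nonneg _)
    · refine ae_of_all _ fun z u _ => ?_
      have h := (hσ.contDiff z.1).ftaylorSeries.fderiv k (mod_cast WithTop.coe_lt_top _) u
      exact h.const_smul (c z)
  refine ⟨fun w => ?_, fun k _ w => hdiff k w, fun k _ =>
    continuous_iff_continuousAt.2 fun w => (hdiff k w).continuousAt⟩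
  have h := (ContinuousMultilinearMap.apply ℝ (fun _ : Fin 0 => E d) ℝ 0).integral_comp_comm
    (hσ.integrable_smul hc 0 w)
  exact h.symm

theorem SmoothKernel.norm_iteratedFDeriv_potential_le (hσ : SmoothKernel σ) (hc : Integrable c π)
    {k : ℕ} {C : ℝ} (hC : ∀ w x, ‖iteratedFDeriv ℝ k (fun w => σ w x) w‖ ≤ C) (w : E d) :
    ‖iteratedFDeriv ℝ k (potential π σ c) w‖ ≤ C * ∫ z, |c z| ∂π := by
  rw [← (hσ.hasFTaylorSeriesUpTo_potential hc).eq_iteratedFDeriv (m := k) (mod_cast le_top) w,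
    mul_comm, ← integral_mul_const]
  refine norm_integral_le_of_norm_le (hc.norm.mul_const C) (ae_of_all _ fun z => ?_)
  rw [norm_smul]
  exact mul_le_mul_of_nonneg_left (hC _ _) (norm_nonneg _)

theorem SmoothKernel.bddSmooth_potential (hσ : SmoothKernel σ) (hc : Integrable c π) :
    BddSmooth (potential π σ c) :=
  ⟨(hσ.hasFTaylorSeriesUpTo_potential hc).contDiff, fun k => by
    obtain ⟨C, hC⟩ := hσ.norm_le k
    exact ⟨_, hσ.norm_iteratedFDeriv_potential_le hc hC⟩⟩

theorem SmoothKernel.inner_gradient_potential (hσ : SmoothKernel σ) (hc : Integrable c π)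
    (v w : E d) : inner ℝ v (gradient (potential π σ c) w) =
      ∫ z, c z * inner ℝ v (gradient (fun w => σ w z.1) w) ∂π := by
  simp only [inner_gradient_right]
  have h := (ContinuousMultilinearMap.apply ℝ (fun _ : Fin 1 => E d) ℝ
    (fun _ => v)).integral_comp_comm (hσ.integrable_smul hc 1 w)
  have h2 := (hσ.hasFTaylorSeriesUpTo_potential hc).eq_iteratedFDeriv (m := 1)
    (mod_cast le_top) w
  have h3 := congrArg (fun q => q (fun _ => v)) h2
  simp only [iteratedFDeriv_one_apply] at h3
  rw [← h3]
  refine h.symm.trans (integral_congr_ae (ae_of_all _ fun z => ?_))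
  simp

theorem SmoothKernel.potential_sub (hσ : SmoothKernel σ) {c' : X × Y → ℝ} (hc : Integrable c π)
    (hc' : Integrable c' π) (w : E d) :
    potential π σ (fun z => c z - c' z) w = potential π σ c w - potential π σ c' w := by
  have h : ∀ {a : X × Y → ℝ}, Integrable a π → Integrable (fun z => a z * σ w z.1) π := by
    intro a ha
    exact (ContinuousMultilinearMap.apply ℝ (fun _ : Fin 0 => E d) ℝ 0).integrable_comp
      (hσ.integrable_smul ha 0 w)
  rw [potential, potential, potential, ← integral_sub (h hc) (h hc')]
  simp only [sub_mul]

/-- Exchange of the average over the data and the average over the parameters. -/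
theorem SmoothKernel.integral_inner_gradient_potential (hσ : SmoothKernel σ) [SFinite π]
    (hc : Integrable c π) (ρ : Measure (E d)) [IsFiniteMeasure ρ] {f : E d → ℝ}
    (hf : BddSmooth f) :
    ∫ z, c z * (∫ w, inner ℝ (gradient f w) (gradient (fun w => σ w z.1) w) ∂ρ) ∂π =
      ∫ w, inner ℝ (gradient f w) (gradient (potential π σ c) w) ∂ρ := by
  simp only [hσ.inner_gradient_potential hc, ← integral_const_mul]
  -- Fubini applies because the integrand is dominated by |c| times the suprema of ‖∇f‖ and ‖∇σ‖,
  -- and ρ is finite.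
  refine integral_integral_swap ?_
  obtain ⟨A, hA⟩ := hf.2 1
  obtain ⟨C, hC⟩ := hσ.norm_le 1
  have hcont : Continuous fun p : E d × X =>
      (inner ℝ (gradient f p.1) (gradient (fun w => σ w p.2) p.1) : ℝ) :=
    (hf.gradient_right.1.continuous.comp continuous_fst).inner hσ.continuous_gradient
  have hm : AEStronglyMeasurable (fun p : (X × Y) × E d =>
      (inner ℝ (gradient f p.2) (gradient (fun w => σ w p.1.1) p.2) : ℝ)) (π.prod ρ) :=
    (hcont.stronglyMeasurable.comp_measurable (by fun_prop :
      Measurable fun p : (X × Y) × E d => (p.2, p.1.1))).aestronglyMeasurable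
  have hcp : Integrable (fun p : (X × Y) × E d => c p.1) (π.prod ρ) := hc.comp_fst ρ
  refine Integrable.mono' (hcp.norm.mul_const (A * C)) (hcp.aestronglyMeasurable.mul hm)
    (ae_of_all _ fun p => ?_)
  simp only [Function.uncurry, norm_mul]
  refine mul_le_mul_of_nonneg_left ?_ (norm_nonneg _)
  refine (norm_inner_le_norm _ _).trans ?_
  rw [norm_gradient, norm_gradient, ← norm_iteratedFDeriv_one, ← norm_iteratedFDeriv_one]
  exact mul_le_mul (hA _) (hC _ _) (norm_nonneg _) ((norm_nonneg _).trans (hA p.2))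

end Potential

/-! ### Regularity of the mean-field drift -/

section Coefficient

variable {d : ℕ} {X : Type*} [TopologicalSpace X] [SecondCountableTopology X] [MeasurableSpace X]
  [OpensMeasurableSpace X] {𝒴 : Set ℝ} {σ : E d → X → ℝ} {π : Measure (X × 𝒴)}
  {ρ ρ' : Measure (E d)}

/-- The weight `α (y - ⟨σ(·, x), ρ⟩)` of the data point `(x, y)`. -/
noncomputable def dataWeight (𝒴 : Set ℝ) (α : ℝ) (σ : E d → X → ℝ) (ρ : Measure (E d))
    (z : X × 𝒴) : ℝ :=
  α * ((z.2 : ℝ) - ∫ w, σ w z.1 ∂ρ)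

/-- The velocity field of the limit equation. -/
noncomputable def meanFieldDrift (π : Measure (X × 𝒴)) (α : ℝ) (σ : E d → X → ℝ)
    (ρ : Measure (E d)) : E d → E d :=
  gradient (potential π σ (dataWeight 𝒴 α σ ρ))

omit [SecondCountableTopology X] [MeasurableSpace X] [OpensMeasurableSpace X] in
theorem SmoothKernel.exists_bound (hσ : SmoothKernel σ) (N : ℕ) :
    ∃ C, 0 ≤ C ∧ ∀ k < N, ∀ w x, ‖iteratedFDeriv ℝ k (fun w => σ w x) w‖ ≤ C := by
  choose C hC using hσ.norm_le
  refine ⟨∑ k ∈ Finset.range N, |C k|, Finset.sum_nonneg fun _ _ => abs_nonneg _,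
    fun k hk w x => ((hC k w x).trans (le_abs_self _)).trans ?_⟩
  exact Finset.single_le_sum (f := fun k => |C k|) (fun _ _ => abs_nonneg _)
    (Finset.mem_range.2 hk)

omit [TopologicalSpace X] [SecondCountableTopology X] [MeasurableSpace X] [OpensMeasurableSpace X] in
theorem abs_mean_le [IsProbabilityMeasure ρ] {C : ℝ}
    (hC : ∀ w x, ‖iteratedFDeriv ℝ 0 (fun w => σ w x) w‖ ≤ C) (x : X) :
    |∫ w, σ w x ∂ρ| ≤ C := by
  have h := norm_integral_le_of_norm_le_const (μ := ρ) (f := fun w => σ w x) (C := C)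
    (ae_of_all _ fun w => by simpa using hC w x)
  simpa using h

omit [MeasurableSpace X] [OpensMeasurableSpace X] in
theorem SmoothKernel.continuous_mean (hσ : SmoothKernel σ) [IsProbabilityMeasure ρ] :
    Continuous fun x => ∫ w, σ w x ∂ρ := by
  obtain ⟨C, hC⟩ := hσ.norm_le 0
  refine continuous_of_dominated (bound := fun _ => C)
    (fun x => (hσ.bddSmooth x).1.continuous.aestronglyMeasurable)
    (fun x => ae_of_all _ fun w => by simpa using hC w x) (integrable_const _)
    (ae_of_all _ fun w => hσ.continuous.comp (by fun_prop : Continuous fun x : X => (w, x)))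

theorem SmoothKernel.integrable_dataWeight (hσ : SmoothKernel σ) [IsFiniteMeasure π]
    [IsProbabilityMeasure ρ] (hy : Integrable (fun z : X × 𝒴 => (z.2 : ℝ)) π) (α : ℝ) :
    Integrable (dataWeight 𝒴 α σ ρ) π := by
  obtain ⟨C, hC⟩ := hσ.norm_le 0
  refine (hy.sub (Integrable.of_bound ?_ C
    (ae_of_all _ fun z => abs_mean_le (ρ := ρ) hC z.1))).const_mul α
  exact (hσ.continuous_mean.stronglyMeasurable.comp_measurable
    measurable_fst).aestronglyMeasurable

theorem SmoothKernel.integral_abs_dataWeight_le (hσ : SmoothKernel σ) [IsProbabilityMeasure π]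
    [IsProbabilityMeasure ρ] (hy : Integrable (fun z : X × 𝒴 => (z.2 : ℝ)) π) (α : ℝ) {C : ℝ}
    (hC : ∀ w x, ‖iteratedFDeriv ℝ 0 (fun w => σ w x) w‖ ≤ C) :
    ∫ z, |dataWeight 𝒴 α σ ρ z| ∂π ≤ |α| * (∫ z, |(z.2 : ℝ)| ∂π + C) := by
  have h : ∫ z, |α| * (|(z.2 : ℝ)| + C) ∂π = |α| * (∫ z, |(z.2 : ℝ)| ∂π + C) := by
    rw [integral_const_mul, integral_add hy.abs (integrable_const _)]
    simp
  rw [← h]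
  refine integral_mono (hσ.integrable_dataWeight hy α).abs
    ((hy.abs.add (integrable_const _)).const_mul _) fun z => ?_
  simp only [dataWeight, abs_mul]
  gcongr
  exact (abs_sub _ _).trans (add_le_add_right (abs_mean_le hC _) _)

/-- The velocity field of the limit equation is regular. -/
theorem SmoothKernel.exists_regularDrift (hσ : SmoothKernel σ) [IsProbabilityMeasure π]
    (hy : Integrable (fun z : X × 𝒴 => (z.2 : ℝ)) π) (α : ℝ) :
    ∃ M, RegularDrift (meanFieldDrift π α σ) M := by
  -- Orders 0 to 3 are needed: the drift is already a gradient, and the Lipschitz bound on its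
  -- derivative takes two more orders. The constant K below bounds the L¹ norm of the weight
  -- uniformly in ρ.
  obtain ⟨C, hC0, hC⟩ := hσ.exists_bound 4
  set K := |α| * (∫ z, |(z.2 : ℝ)| ∂π + C)
  have hK : 0 ≤ K := mul_nonneg (abs_nonneg _)
    (add_nonneg (integral_nonneg fun _ => abs_nonneg _) hC0)
  have hCK : 0 ≤ C * K := mul_nonneg hC0 hK
  have hαC : 0 ≤ |α| * C * C := by positivity
  have hM : C * K ≤ C * K + |α| * C * C := by linarith
  have hΦ : ∀ (ρ : Measure (E d)) [IsProbabilityMeasure ρ] (k : ℕ), k < 4 → ∀ w,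
      ‖iteratedFDeriv ℝ k (potential π σ (dataWeight 𝒴 α σ ρ)) w‖ ≤ C * K + |α| * C * C := by
    intro ρ _ k hk w
    refine ((hσ.norm_iteratedFDeriv_potential_le (hσ.integrable_dataWeight hy α) (hC k hk)
      w).trans ?_).trans hM
    exact mul_le_mul_of_nonneg_left (hσ.integral_abs_dataWeight_le hy α (hC 0 (by norm_num))) hC0
  have hs : ∀ (ρ : Measure (E d)) [IsProbabilityMeasure ρ],
      BddSmooth (potential π σ (dataWeight 𝒴 α σ ρ)) :=
    fun ρ _ => hσ.bddSmooth_potential (hσ.integrable_dataWeight hy α)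
  refine ⟨C * K + |α| * C * C, by positivity, fun ρ _ => (hs ρ).gradient_right, fun ρ _ w => ?_,
    fun ρ _ w => ?_, fun ρ _ => ?_, fun ρ ρ' _ _ e he w => ?_⟩
  · rw [meanFieldDrift, norm_gradient, ← norm_iteratedFDeriv_one]
    exact hΦ ρ 1 (by norm_num) w
  · rw [meanFieldDrift, ← norm_iteratedFDeriv_one]
    exact (norm_iteratedFDeriv_gradient_le (hs ρ).1 1 w).trans (hΦ ρ 2 (by norm_num) w)
  · exact norm_fderiv_sub_le_of_norm_iteratedFDeriv_two_le (hs ρ).gradient_right.1 fun w =>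
      (norm_iteratedFDeriv_gradient_le (hs ρ).1 2 w).trans (hΦ ρ 3 (by norm_num) w)
  -- Each σ(·, x) is itself an admissible test function with a constant independent of x. Hence the
  -- weights of ρ and ρ' differ by at most |α| C e.
  · have hσC : ∀ x, DerivBound C (fun w => σ w x) := fun x =>
      .of_iteratedFDeriv (hσ.bddSmooth x) (fun w => hC 1 (by norm_num) w x)
        (fun w => hC 2 (by norm_num) w x)
    have he0 : 0 ≤ e := by
      have h := he 1 (fun _ => 0) ⟨.const 0, fun w => by simp, fun u w => by simp⟩
      simpa using h
    have hi := hσ.integrable_dataWeight (ρ := ρ) hy α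
    have hi' := hσ.integrable_dataWeight (ρ := ρ') hy α
    have hsub : fderiv ℝ (potential π σ (dataWeight 𝒴 α σ ρ)) w -
        fderiv ℝ (potential π σ (dataWeight 𝒴 α σ ρ')) w =
        fderiv ℝ (potential π σ fun z => dataWeight 𝒴 α σ ρ z - dataWeight 𝒴 α σ ρ' z) w := by
      rw [← fderiv_fun_sub ((hs ρ).differentiable w) ((hs ρ').differentiable w)]
      congr 1
      funext u
      exact (hσ.potential_sub hi hi' u).symm
    rw [meanFieldDrift, meanFieldDrift, norm_gradient_sub, hsub, ← norm_iteratedFDeriv_one]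
    refine (hσ.norm_iteratedFDeriv_potential_le (hi.sub hi') (hC 1 (by norm_num)) w).trans ?_
    have hle : ∫ z, |dataWeight 𝒴 α σ ρ z - dataWeight 𝒴 α σ ρ' z| ∂π ≤ |α| * (C * e) := by
      have h := integral_mono (μ := π) (hi.sub hi').abs (integrable_const (|α| * (C * e)))
        fun z => by
          have hz : dataWeight 𝒴 α σ ρ z - dataWeight 𝒴 α σ ρ' z =
              -α * (∫ w, σ w z.1 ∂ρ - ∫ w, σ w z.1 ∂ρ') := by
            simp only [dataWeight]
            ring
          simp only [Pi.sub_apply, hz, abs_mul, abs_neg]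
          exact mul_le_mul_of_nonneg_left (he C _ (hσC z.1)) (abs_nonneg _)
      simpa using h
    calc _ ≤ C * (|α| * (C * e)) := mul_le_mul_of_nonneg_left hle hC0
      _ = |α| * C * C * e := by ring
      _ ≤ (C * K + |α| * C * C) * e := mul_le_mul_of_nonneg_right (by linarith) he0

end Coefficient

/-! ### Weak solutions and the Wasserstein distance -/

variable {d : ℕ}

/-- Weak solutions of the continuity equation with the measure dependent velocity field `b`. -/
def IsWeakSolution (b : Measure (E d) → E d → E d) (μ₀ : Measure (E d)) (μ : ℝ≥0 → P1 d) : Prop :=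
  ∀ f : E d → ℝ, BddSmooth f → ∀ t : ℝ≥0,
    ∫ w, f w ∂(μ t).toMeasure = ∫ w, f w ∂μ₀ +
      ∫ s in (0 : ℝ)..(t : ℝ), ∫ w, inner ℝ (gradient f w) (b (μ s.toNNReal).toMeasure w)
        ∂(μ s.toNNReal).toMeasure

/-- The easy half of Kantorovich duality. The strict inequality supplies a coupling of cost below ε,
so no optimal coupling is needed. -/
theorem abs_integral_sub_le_of_W1_lt {μ ν : P1 d} {ε : ℝ} (h : W1 μ ν < ENNReal.ofReal ε)
    {f : E d → ℝ} (hf : BddSmooth f) {q : ℝ} (hq : ∀ u w, |f u - f w| ≤ q * ‖u - w‖)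
    (hq0 : 0 ≤ q) :
    |∫ w, f w ∂μ.toMeasure - ∫ w, f w ∂ν.toMeasure| ≤ q * ε := by
  simp only [W1, iInf_lt_iff] at h
  obtain ⟨γ, h1, h2, h⟩ := h
  have hε : 0 ≤ ε := (ENNReal.ofReal_pos.1 (pos_of_gt h)).le
  have hi1 : Integrable f (γ.map Prod.fst) := h1 ▸ hf.integrable μ.toMeasure
  have hi2 : Integrable f (γ.map Prod.snd) := h2 ▸ hf.integrable ν.toMeasure
  rw [← h1, ← h2, integral_map measurable_fst.aemeasurable hi1.1,
    integral_map measurable_snd.aemeasurable hi2.1,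
    ← integral_sub (f := fun z : E d × E d => f z.1) (g := fun z : E d × E d => f z.2)
      (hi1.comp_measurable measurable_fst) (hi2.comp_measurable measurable_snd),
    ← Real.norm_eq_abs, ← ENNReal.ofReal_le_ofReal_iff (mul_nonneg hq0 hε), ofReal_norm]
  calc _ ≤ ∫⁻ z, ‖f z.1 - f z.2‖ₑ ∂γ := enorm_integral_le_lintegral_enorm _
    _ ≤ ∫⁻ z, ENNReal.ofReal q * edist z.1 z.2 ∂γ := by
        refine lintegral_mono fun z => ?_
        rw [edist_dist, dist_eq_norm, ← ENNReal.ofReal_mul hq0, ← ofReal_norm, Real.norm_eq_abs]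
        exact ENNReal.ofReal_le_ofReal (hq _ _)
    _ = ENNReal.ofReal q * ∫⁻ z, edist z.1 z.2 ∂γ :=
        lintegral_const_mul' _ _ ENNReal.ofReal_ne_top
    _ ≤ ENNReal.ofReal q * ENNReal.ofReal ε := by gcongr
    _ = ENNReal.ofReal (q * ε) := (ENNReal.ofReal_mul hq0).symm

/-! ### Uniqueness by the explicit Euler scheme -/

namespace RegularDrift

variable {b : Measure (E d) → E d → E d} {M : ℝ} {μ₀ : Measure (E d)} {μ ν : ℝ≥0 → P1 d}

/-- The rate of change of `⟨f, ρ⟩` along the continuity equation. -/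
noncomputable def rate (b : Measure (E d) → E d → E d) (f : E d → ℝ) (ρ : Measure (E d)) : ℝ :=
  ∫ w, inner ℝ (gradient f w) (b ρ w) ∂ρ

theorem bddSmooth_inner (hb : RegularDrift b M) {f : E d → ℝ} (hf : BddSmooth f)
    (ρ : Measure (E d)) [IsProbabilityMeasure ρ] :
    BddSmooth (fun w => inner ℝ (gradient f w) (b ρ w)) :=
  hf.gradient_right.real_inner (hb.smooth ρ)

theorem abs_inner_le (hb : RegularDrift b M) {f : E d → ℝ} {q : ℝ}
    (hq : ∀ w, ‖fderiv ℝ f w‖ ≤ q) (ρ : Measure (E d)) [IsProbabilityMeasure ρ] (w : E d) :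
    |inner ℝ (gradient f w) (b ρ w)| ≤ q * M := by
  refine (abs_real_inner_le_norm _ _).trans ?_
  rw [norm_gradient]
  exact mul_le_mul (hq w) (hb.norm_le ρ w) (norm_nonneg _) ((norm_nonneg _).trans (hq w))

theorem abs_rate_le (hb : RegularDrift b M) {f : E d → ℝ} {q : ℝ}
    (hq : ∀ w, ‖fderiv ℝ f w‖ ≤ q) (ρ : Measure (E d)) [IsProbabilityMeasure ρ] :
    |rate b f ρ| ≤ q * M := by
  have h := norm_integral_le_of_norm_le_const (μ := ρ) (C := q * M)
    (f := fun w => (inner ℝ (gradient f w) (b ρ w) : ℝ))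
    (ae_of_all _ fun w => hb.abs_inner_le hq ρ w)
  rw [rate]
  simpa using h

theorem norm_sub_le_mul (hb : RegularDrift b M) (ρ : Measure (E d)) [IsProbabilityMeasure ρ]
    (u w : E d) : ‖b ρ u - b ρ w‖ ≤ M * ‖u - w‖ :=
  convex_univ.norm_image_sub_le_of_norm_fderiv_le (𝕜 := ℝ)
    (fun x _ => (hb.smooth ρ).differentiable x) (fun x _ => hb.norm_fderiv_le ρ x)
    (Set.mem_univ w) (Set.mem_univ u)

theorem abs_inner_sub_le (hb : RegularDrift b M) {f : E d → ℝ} {q : ℝ} (hf : DerivBound q f)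
    (ρ : Measure (E d)) [IsProbabilityMeasure ρ] (u w : E d) :
    |inner ℝ (gradient f u) (b ρ u) - inner ℝ (gradient f w) (b ρ w)| ≤ 2 * q * M * ‖u - w‖ := by
  have h : inner ℝ (gradient f u) (b ρ u) - inner ℝ (gradient f w) (b ρ w) =
      inner ℝ (gradient f u - gradient f w) (b ρ u) +
        inner ℝ (gradient f w) (b ρ u - b ρ w) := by
    rw [inner_sub_left, inner_sub_right]
    ring
  have h1 : |inner ℝ (gradient f u - gradient f w) (b ρ u)| ≤ q * ‖u - w‖ * M := by
    refine (abs_real_inner_le_norm _ _).trans ?_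
    rw [norm_gradient_sub]
    exact mul_le_mul (hf.sub_le u w) (hb.norm_le ρ u) (norm_nonneg _)
      (mul_nonneg hf.nonneg (norm_nonneg _))
  have h2 : |inner ℝ (gradient f w) (b ρ u - b ρ w)| ≤ q * (M * ‖u - w‖) := by
    refine (abs_real_inner_le_norm _ _).trans ?_
    rw [norm_gradient]
    exact mul_le_mul (hf.norm_le w) (hb.norm_sub_le_mul ρ u w) (norm_nonneg _) hf.nonneg
  rw [h]
  refine (abs_add_le _ _).trans ((add_le_add h1 h2).trans_eq (by ring))

/-- If `ρ` and `ρ'` are `e`-close in the weak sense, then so are the rates of change. -/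
theorem abs_rate_sub_le (hb : RegularDrift b M) {f : E d → ℝ} {q : ℝ} (hf : DerivBound q f)
    {ρ ρ' : Measure (E d)} [IsProbabilityMeasure ρ] [IsProbabilityMeasure ρ'] {e : ℝ}
    (he : ∀ (q : ℝ) (f : E d → ℝ), BddSmooth f → 0 ≤ q → (∀ u w, |f u - f w| ≤ q * ‖u - w‖) →
      |∫ w, f w ∂ρ - ∫ w, f w ∂ρ'| ≤ q * e) :
    |rate b f ρ - rate b f ρ'| ≤ 3 * q * M * e := by
  have hi := (hb.bddSmooth_inner hf.smooth ρ').integrable ρ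
  -- First the drift changes under the fixed law ρ, at cost q M e; then the law changes under the
  -- fixed drift b(ρ'), at cost 2 q M e.
  have h : rate b f ρ - rate b f ρ' =
      (∫ w, (inner ℝ (gradient f w) (b ρ w) - inner ℝ (gradient f w) (b ρ' w)) ∂ρ) +
      (∫ w, inner ℝ (gradient f w) (b ρ' w) ∂ρ - ∫ w, inner ℝ (gradient f w) (b ρ' w) ∂ρ') := by
    rw [integral_sub ((hb.bddSmooth_inner hf.smooth ρ).integrable ρ) hi, rate, rate]
    ring
  have hbe := hb.norm_sub_le ρ ρ' e fun q f hf => he q f hf.smooth hf.nonneg hf.abs_sub_le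
  have h1 : |∫ w, (inner ℝ (gradient f w) (b ρ w) - inner ℝ (gradient f w) (b ρ' w)) ∂ρ| ≤
      q * (M * e) := by
    have h := norm_integral_le_of_norm_le_const (μ := ρ) (C := q * (M * e))
      (f := fun w => inner ℝ (gradient f w) (b ρ w) - inner ℝ (gradient f w) (b ρ' w))
      (ae_of_all _ fun w => by
        rw [← inner_sub_right]
        refine (norm_inner_le_norm _ _).trans ?_
        rw [norm_gradient]
        exact mul_le_mul (hf.norm_le w) (hbe w) (norm_nonneg _) hf.nonneg)
    simpa using h
  -- The function ∇f · b(ρ') is Lipschitz, but q gives no Lipschitz bound on its gradient, which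
  -- would involve third derivatives of f. This is why `he` allows every Lipschitz bounded smooth
  -- function.
  have h2 := he _ _ (hb.bddSmooth_inner hf.smooth ρ')
    (mul_nonneg (mul_nonneg zero_le_two hf.nonneg) hb.nonneg) (hb.abs_inner_sub_le hf ρ')
  rw [h]
  exact (abs_add_le _ _).trans ((add_le_add h1 h2).trans_eq (by ring))

theorem continuous_rate (hb : RegularDrift b M) (hμ : IsW1Continuous μ) {f : E d → ℝ}
    (hf : BddSmooth f) : Continuous fun s : ℝ => rate b f (μ s.toNNReal).toMeasure := by
  obtain ⟨q, hq⟩ := hf.exists_derivBound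
  suffices h : Continuous fun s : ℝ≥0 => rate b f (μ s).toMeasure from
    h.comp continuous_real_toNNReal
  refine continuous_iff_continuousAt.2 fun t => Metric.tendsto_nhds.2 fun ε hε => ?_
  have hc : 0 < 3 * q * M + 1 := by have := hq.nonneg; have := hb.nonneg; positivity
  have hδ : 0 < ε / (3 * q * M + 1) := by positivity
  have hev := (hμ t).eventually (gt_mem_nhds (ENNReal.ofReal_pos.2 hδ))
  filter_upwards [hev] with s hs
  rw [Real.dist_eq]
  refine (hb.abs_rate_sub_le hq fun q f hf hq0 hq =>
    abs_integral_sub_le_of_W1_lt hs hf hq hq0).trans_lt ?_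
  rw [mul_div_assoc', div_lt_iff₀ hc]
  linarith

theorem integral_sub_eq (hb : RegularDrift b M) (hμ : IsW1Continuous μ)
    (hs : IsWeakSolution b μ₀ μ) {f : E d → ℝ} (hf : BddSmooth f) (s t : ℝ≥0) :
    ∫ w, f w ∂(μ t).toMeasure - ∫ w, f w ∂(μ s).toMeasure =
      ∫ r in (s : ℝ)..(t : ℝ), rate b f (μ r.toNNReal).toMeasure := by
  have hc := hb.continuous_rate hμ hf
  rw [hs f hf t, hs f hf s, add_sub_add_left_eq_sub]
  exact intervalIntegral.integral_interval_sub_left (hc.intervalIntegrable _ _)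
    (hc.intervalIntegrable _ _)

/-- Mass moves at speed at most M. This controls how far the rate drifts from its frozen value
during one Euler step. -/
theorem abs_integral_sub_le (hb : RegularDrift b M) (hμ : IsW1Continuous μ)
    (hs : IsWeakSolution b μ₀ μ) {f : E d → ℝ} (hf : BddSmooth f) {q : ℝ}
    (hq : ∀ w, ‖fderiv ℝ f w‖ ≤ q) (s t : ℝ≥0) :
    |∫ w, f w ∂(μ t).toMeasure - ∫ w, f w ∂(μ s).toMeasure| ≤ q * (M * |(t : ℝ) - s|) := by
  rw [hb.integral_sub_eq hμ hs hf s t, ← mul_assoc]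
  exact intervalIntegral.norm_integral_le_of_norm_le_const (C := q * M)
    (f := fun r => rate b f (μ r.toNNReal).toMeasure) fun r _ => hb.abs_rate_le hq _

theorem norm_fderiv_le_of_abs_sub_le {f : E d → ℝ} {q : ℝ} (hq0 : 0 ≤ q)
    (hq : ∀ u w, |f u - f w| ≤ q * ‖u - w‖) (w : E d) : ‖fderiv ℝ f w‖ ≤ q :=
  norm_fderiv_le_of_lip' ℝ hq0 (Eventually.of_forall fun u => hq u w)

/-- Consistency of the explicit Euler scheme. -/
theorem abs_integral_sub_euler_le (hb : RegularDrift b M) (hμ : IsW1Continuous μ)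
    (hs : IsWeakSolution b μ₀ μ) {f : E d → ℝ} {q : ℝ} (hf : DerivBound q f) (s h : ℝ≥0) :
    |∫ w, f w ∂(μ (s + h)).toMeasure -
      ∫ w, f (w + (h : ℝ) • b (μ s).toMeasure w) ∂(μ s).toMeasure| ≤ q * (4 * M ^ 2 * h ^ 2) := by
  -- Error of freezing the rate at time s: the law moves by at most M h, and the rate by 3 q M times
  -- that.
  have h1 : |∫ w, f w ∂(μ (s + h)).toMeasure - ∫ w, f w ∂(μ s).toMeasure -
      h * rate b f (μ s).toMeasure| ≤ 3 * q * M * (M * h) * h := by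
    have hc := hb.continuous_rate hμ hf.smooth
    have e1 : (h : ℝ) * rate b f (μ s).toMeasure =
        ∫ _ in (s : ℝ)..((s + h : ℝ≥0) : ℝ), rate b f (μ s).toMeasure := by
      rw [intervalIntegral.integral_const, NNReal.coe_add, add_sub_cancel_left, smul_eq_mul]
    rw [hb.integral_sub_eq hμ hs hf.smooth, e1,
      ← intervalIntegral.integral_sub (hc.intervalIntegrable _ _)
        (continuous_const.intervalIntegrable _ _)]
    have h2 := intervalIntegral.norm_integral_le_of_norm_le_const (a := (s : ℝ))
      (b := ((s + h : ℝ≥0) : ℝ)) (C := 3 * q * M * (M * h))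
      (f := fun r => rate b f (μ r.toNNReal).toMeasure - rate b f (μ s).toMeasure)
      fun r hr => by
        rw [Set.uIoc_of_le (by simp), NNReal.coe_add] at hr
        have hr0 : 0 ≤ r := s.2.trans hr.1.le
        refine (hb.abs_rate_sub_le hf (e := M * |((r.toNNReal : ℝ≥0) : ℝ) - s|)
          fun q f hf hq0 hq => hb.abs_integral_sub_le hμ hs hf
            (norm_fderiv_le_of_abs_sub_le hq0 hq) s r.toNNReal).trans ?_
        have := hf.nonneg
        have := hb.nonneg
        gcongr
        rw [Real.coe_toNNReal r hr0, abs_of_nonneg (by linarith [hr.1])]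
        linarith [hr.2]
    simpa using h2
  -- Taylor error of f along a displacement of length at most h M. Together with the freezing error
  -- this gives the factor 4 = 3 + 1.
  have h2 : |∫ w, f (w + (h : ℝ) • b (μ s).toMeasure w) ∂(μ s).toMeasure -
      ∫ w, f w ∂(μ s).toMeasure - h * rate b f (μ s).toMeasure| ≤ q * (h * M) ^ 2 := by
    have hi := hf.smooth.integrable (μ s).toMeasure
    have hi1 := (hf.smooth.comp_add_smul (hb.smooth (μ s).toMeasure) h).integrable
      (μ s).toMeasure
    have hi2 := (hb.bddSmooth_inner hf.smooth (μ s).toMeasure).integrable (μ s).toMeasure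
    rw [rate, ← integral_const_mul, ← integral_sub hi1 hi,
      ← integral_sub (f := fun w => f (w + (h : ℝ) • b (μ s).toMeasure w) - f w)
        (hi1.sub hi) (hi2.const_mul _)]
    have h3 := norm_integral_le_of_norm_le_const (μ := (μ s).toMeasure) (C := q * (h * M) ^ 2)
      (f := fun w => f (w + (h : ℝ) • b (μ s).toMeasure w) - f w -
        h * inner ℝ (gradient f w) (b (μ s).toMeasure w))
      (ae_of_all _ fun w => by
        rw [← real_inner_smul_right]
        refine (hf.abs_taylor_le _ _).trans ?_
        have := hf.nonneg
        rw [norm_smul, Real.norm_of_nonneg (NNReal.coe_nonneg h)]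
        gcongr
        exact hb.norm_le _ w)
    simpa using h3
  rw [abs_le] at h1 h2 ⊢
  constructor <;> nlinarith [h1.1, h1.2, h2.1, h2.2]

/-- Stability of the class of test functions under the explicit Euler scheme. -/
theorem derivBound_euler (hb : RegularDrift b M) {f : E d → ℝ} {q : ℝ} (hf : DerivBound q f)
    (ρ : Measure (E d)) [IsProbabilityMeasure ρ] {h : ℝ} (h0 : 0 ≤ h) (h1 : h ≤ 1) :
    DerivBound (q * (1 + h * (3 * M + M ^ 2))) (fun w => f (w + h • b ρ w)) := by
  have hq := hf.nonneg
  have hM := hb.nonneg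
  set S : E d → E d := fun w => w + h • b ρ w
  set S' : E d → E d →L[ℝ] E d := fun w => ContinuousLinearMap.id ℝ (E d) + h • fderiv ℝ (b ρ) w
  have hS : ∀ w, HasFDerivAt S (S' w) w := fun w =>
    (hasFDerivAt_id w).add (((hb.smooth ρ).differentiable w).hasFDerivAt.const_smul h)
  have hd : ∀ w, fderiv ℝ (fun w => f (S w)) w = (fderiv ℝ f (S w)).comp (S' w) := fun w =>
    ((hf.smooth.differentiable (S w)).hasFDerivAt.comp w (hS w)).fderiv
  have hS'n : ∀ w, ‖S' w‖ ≤ 1 + h * M := fun w => by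
    refine (norm_add_le _ _).trans (add_le_add ContinuousLinearMap.norm_id_le ?_)
    rw [norm_smul, Real.norm_of_nonneg h0]
    exact mul_le_mul_of_nonneg_left (hb.norm_fderiv_le ρ w) h0
  have hSl : ∀ u w, ‖S u - S w‖ ≤ (1 + h * M) * ‖u - w‖ := fun u w =>
    convex_univ.norm_image_sub_le_of_norm_hasFDerivWithin_le (𝕜 := ℝ)
      (fun x _ => (hS x).hasFDerivWithinAt) (fun x _ => hS'n x) (Set.mem_univ w) (Set.mem_univ u)
  have hS'l : ∀ u w, ‖S' u - S' w‖ ≤ h * M * ‖u - w‖ := fun u w => by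
    have : S' u - S' w = h • (fderiv ℝ (b ρ) u - fderiv ℝ (b ρ) w) := by
      simp only [S', smul_sub]
      abel
    rw [this, norm_smul, Real.norm_of_nonneg h0, mul_assoc]
    exact mul_le_mul_of_nonneg_left (hb.norm_fderiv_sub_le ρ u w) h0
  refine ⟨hf.smooth.comp_add_smul (hb.smooth ρ) h, fun w => ?_, fun u w => ?_⟩
  · rw [hd]
    refine (ContinuousLinearMap.opNorm_comp_le _ _).trans ?_
    refine (mul_le_mul (hf.norm_le _) (hS'n w) (norm_nonneg _) hq).trans ?_
    have : 0 ≤ h * (2 * M + M ^ 2) := by positivity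
    exact mul_le_mul_of_nonneg_left (by linarith) hq
  · rw [hd, hd]
    have h2 : (fderiv ℝ f (S u)).comp (S' u) - (fderiv ℝ f (S w)).comp (S' w) =
        (fderiv ℝ f (S u) - fderiv ℝ f (S w)).comp (S' u) +
          (fderiv ℝ f (S w)).comp (S' u - S' w) := by
      rw [ContinuousLinearMap.sub_comp, ContinuousLinearMap.comp_sub]
      abel
    have h3 : ‖(fderiv ℝ f (S u) - fderiv ℝ f (S w)).comp (S' u)‖ ≤
        q * ((1 + h * M) * ‖u - w‖) * (1 + h * M) := by
      refine (ContinuousLinearMap.opNorm_comp_le _ _).trans ?_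
      refine mul_le_mul ((hf.sub_le _ _).trans (mul_le_mul_of_nonneg_left (hSl u w) hq)) (hS'n u)
        (norm_nonneg _) (by positivity)
    have h4 : ‖(fderiv ℝ f (S w)).comp (S' u - S' w)‖ ≤ q * (h * M * ‖u - w‖) :=
      (ContinuousLinearMap.opNorm_comp_le _ _).trans
        (mul_le_mul (hf.norm_le _) (hS'l u w) (norm_nonneg _) hq)
    rw [h2]
    refine (norm_add_le _ _).trans ((add_le_add h3 h4).trans ?_)
    -- The Lipschitz constant of the new gradient is q((1 + hM)² + hM) = q(1 + 3hM + h²M²); h ≤ 1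
    -- makes the last term linear in h.
    have h5 : h * h * M ^ 2 ≤ h * 1 * M ^ 2 := by gcongr
    have h6 : 0 ≤ q * ‖u - w‖ := by positivity
    nlinarith

/-- One step of the explicit Euler scheme for the difference of two solutions. -/
theorem abs_integral_sub_step (hb : RegularDrift b M) (hμ : IsW1Continuous μ)
    (hsμ : IsWeakSolution b μ₀ μ) (hν : IsW1Continuous ν) (hsν : IsWeakSolution b μ₀ ν)
    {s h : ℝ≥0} (h1 : h ≤ 1) {e : ℝ}
    (he : ∀ (q : ℝ) (f : E d → ℝ), DerivBound q f →
      |∫ w, f w ∂(μ s).toMeasure - ∫ w, f w ∂(ν s).toMeasure| ≤ q * e)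
    {f : E d → ℝ} {q : ℝ} (hf : DerivBound q f) :
    |∫ w, f w ∂(μ (s + h)).toMeasure - ∫ w, f w ∂(ν (s + h)).toMeasure| ≤
      q * ((1 + h * (4 * M + M ^ 2)) * e + 8 * M ^ 2 * h ^ 2) := by
  -- Chain of four comparisons: the Euler error for μ, the change of drift under μ_s (`hd`), the
  -- change of law for the test function transported by the drift of ν_s (`hst`), and the Euler
  -- error for ν.
  have hμe := hb.abs_integral_sub_euler_le hμ hsμ hf s h
  have hνe := hb.abs_integral_sub_euler_le hν hsν hf s h
  have hst := he _ _ (hb.derivBound_euler hf (ν s).toMeasure (NNReal.coe_nonneg h) h1)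
  have hbe := hb.norm_sub_le _ _ e he
  have hd : |∫ w, f (w + (h : ℝ) • b (μ s).toMeasure w) ∂(μ s).toMeasure -
      ∫ w, f (w + (h : ℝ) • b (ν s).toMeasure w) ∂(μ s).toMeasure| ≤ q * (h * (M * e)) := by
    rw [← integral_sub
      ((hf.smooth.comp_add_smul (hb.smooth (μ s).toMeasure) h).integrable _)
      ((hf.smooth.comp_add_smul (hb.smooth (ν s).toMeasure) h).integrable _)]
    have h3 := norm_integral_le_of_norm_le_const (μ := (μ s).toMeasure) (C := q * (h * (M * e)))
      (f := fun w => f (w + (h : ℝ) • b (μ s).toMeasure w) -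
        f (w + (h : ℝ) • b (ν s).toMeasure w))
      (ae_of_all _ fun w => by
        refine (hf.abs_sub_le _ _).trans (mul_le_mul_of_nonneg_left ?_ hf.nonneg)
        rw [add_sub_add_left_eq_sub, ← smul_sub, norm_smul, Real.norm_of_nonneg (NNReal.coe_nonneg h)]
        exact mul_le_mul_of_nonneg_left (hbe w) (NNReal.coe_nonneg h))
    simpa using h3
  rw [abs_le] at *
  constructor <;> nlinarith

/-- Discrete Gronwall: the initial laws agree on test functions, and each step multiplies the error
by at most exp(h(4M + M²)) and adds 8M²h². The induction keeps f and q general because every step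
changes the test function. -/
theorem abs_integral_sub_iterate (hb : RegularDrift b M) (hμ : IsW1Continuous μ)
    (hsμ : IsWeakSolution b μ₀ μ) (hν : IsW1Continuous ν) (hsν : IsWeakSolution b μ₀ ν)
    {h : ℝ≥0} (h1 : h ≤ 1) (k : ℕ) {f : E d → ℝ} {q : ℝ} (hf : DerivBound q f) :
    |∫ w, f w ∂(μ (k * h)).toMeasure - ∫ w, f w ∂(ν (k * h)).toMeasure| ≤
      q * (8 * M ^ 2 * h ^ 2 * k * Real.exp ((4 * M + M ^ 2) * (k * h))) := by
  have hM := hb.nonneg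
  induction k generalizing f q with
  | zero =>
    have e1 := hsμ f hf.smooth 0
    have e2 := hsν f hf.smooth 0
    simp only [NNReal.coe_zero, intervalIntegral.integral_same, add_zero] at e1 e2
    simp [e1, e2]
  | succ k ih =>
    have hk : ((k + 1 : ℕ) : ℝ≥0) * h = k * h + h := by push_cast; ring
    rw [hk]
    refine (hb.abs_integral_sub_step hμ hsμ hν hsν h1 (fun q f hf => ih hf) hf).trans ?_
    refine mul_le_mul_of_nonneg_left ?_ hf.nonneg
    set Γ := 4 * M + M ^ 2
    have hΓ : 0 ≤ Γ := by positivity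
    have hx : Real.exp (Γ * ((k + 1 : ℕ) * h)) = Real.exp (Γ * (k * h)) * Real.exp (h * Γ) := by
      rw [← Real.exp_add]
      push_cast
      ring_nf
    have hy : 1 + h * Γ ≤ Real.exp (h * Γ) := by linarith [Real.add_one_le_exp (h * Γ)]
    have hz : 1 ≤ Real.exp (Γ * ((k + 1 : ℕ) * h)) := Real.one_le_exp (by positivity)
    have hA : 0 ≤ 8 * M ^ 2 * (h : ℝ) ^ 2 := by positivity
    calc (1 + h * Γ) * (8 * M ^ 2 * h ^ 2 * k * Real.exp (Γ * (k * h))) + 8 * M ^ 2 * h ^ 2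
        ≤ Real.exp (h * Γ) * (8 * M ^ 2 * h ^ 2 * k * Real.exp (Γ * (k * h))) +
            8 * M ^ 2 * h ^ 2 * Real.exp (Γ * ((k + 1 : ℕ) * h)) := by
          refine add_le_add (mul_le_mul_of_nonneg_right hy (by positivity)) ?_
          exact le_mul_of_one_le_right hA hz
      _ = 8 * M ^ 2 * h ^ 2 * (k + 1 : ℕ) * Real.exp (Γ * ((k + 1 : ℕ) * h)) := by
          rw [hx]
          push_cast
          ring

theorem integral_eq (hb : RegularDrift b M) (hμ : IsW1Continuous μ)
    (hsμ : IsWeakSolution b μ₀ μ) (hν : IsW1Continuous ν) (hsν : IsWeakSolution b μ₀ ν)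
    {f : E d → ℝ} (hf : BddSmooth f) (t : ℝ≥0) :
    ∫ w, f w ∂(μ t).toMeasure = ∫ w, f w ∂(ν t).toMeasure := by
  obtain ⟨q, hq⟩ := hf.exists_derivBound
  rw [← sub_eq_zero, ← abs_eq_zero]
  refine le_antisymm ?_ (abs_nonneg _)
  have hlim : Tendsto (fun N : ℕ => q * (8 * M ^ 2 * t ^ 2 * Real.exp ((4 * M + M ^ 2) * t)) *
      (1 / ((N : ℝ) + 1))) atTop (𝓝 0) := by
    have h := (tendsto_one_div_add_atTop_nhds_zero_nat (𝕜 := ℝ)).const_mul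
      (q * (8 * M ^ 2 * (t : ℝ) ^ 2 * Real.exp ((4 * M + M ^ 2) * t)))
    rwa [mul_zero] at h
  refine ge_of_tendsto hlim ?_
  -- With N + 1 steps of length t/(N + 1), N ≥ ⌈t⌉ makes the step at most 1, and the error h²(N + 1)
  -- becomes t²/(N + 1).
  filter_upwards [eventually_ge_atTop ⌈t⌉₊] with N hN
  have hN0 : ((N + 1 : ℕ) : ℝ≥0) ≠ 0 := Nat.cast_ne_zero.2 (Nat.succ_ne_zero N)
  have h1 : t / ((N + 1 : ℕ) : ℝ≥0) ≤ 1 := by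
    refine div_le_one_of_le₀ ((Nat.le_ceil t).trans ?_) zero_le
    exact_mod_cast hN.trans (Nat.le_succ N)
  have h := hb.abs_integral_sub_iterate hμ hsμ hν hsν h1 (N + 1) hq
  rw [mul_div_cancel₀ _ hN0] at h
  refine h.trans_eq ?_
  have hN1 : ((N : ℝ) + 1) ≠ 0 := by positivity
  push_cast
  rw [mul_div_cancel₀ _ hN1]
  field_simp

/-- Uniqueness of weak solutions of the continuity equation. -/
theorem weakSolution_unique (hb : RegularDrift b M) (hμ : IsW1Continuous μ)
    (hsμ : IsWeakSolution b μ₀ μ) (hν : IsW1Continuous ν) (hsν : IsWeakSolution b μ₀ ν) :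
    μ = ν := by
  funext t
  exact Subtype.ext (Subtype.ext (measure_ext_of_bddSmooth (ρ := (μ t).toMeasure)
    (ρ' := (ν t).toMeasure) fun f hf =>
    hb.integral_eq hμ hsμ hν hsν hf t))

end RegularDrift

/-! ### Existence by characteristics -/

open scoped BoundedContinuousFunction

/-- A bounded Lipschitz vector field on a Banach space has global integral curves. -/
theorem exists_global_integralCurve {B : Type*} [NormedAddCommGroup B] [NormedSpace ℝ B]
    [CompleteSpace B] {G : B → B} {K M : ℝ≥0} (hG : LipschitzWith K G) (hM : ∀ x, ‖G x‖ ≤ M)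
    (x₀ : B) : ∃ Z : ℝ → B, Z 0 = x₀ ∧ ∀ t, HasDerivAt Z (G (Z t)) t := by
  have hloc : ∀ N : ℕ, ∃ Z : ℝ → B, Z 0 = x₀ ∧
      ∀ t ∈ Set.Ioo (-((N : ℝ) + 1)) (N + 1), HasDerivAt Z (G (Z t)) t := by
    intro N
    have h0 : (0 : ℝ) ∈ Set.Icc (-((N : ℝ) + 1)) (N + 1) :=
      ⟨by linarith [N.cast_nonneg (α := ℝ)], by positivity⟩
    -- At speed at most M a curve cannot leave the ball of radius M(N + 1) within time N + 1, so the
    -- interval may be arbitrarily long.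
    have hPL : IsPicardLindelof (fun _ => G) (⟨0, h0⟩ : Set.Icc (-((N : ℝ) + 1)) (N + 1)) x₀
        (M * (N + 1)) 0 M K :=
      { lipschitzOnWith := fun _ _ => hG.lipschitzOnWith
        continuousOn := fun _ _ => continuousOn_const
        norm_le := fun _ _ x _ => hM x
        mul_max_le := by simp }
    obtain ⟨Z, hZ0, hZ⟩ := hPL.exists_eq_forall_mem_Icc_hasDerivWithinAt₀
    exact ⟨Z, hZ0, fun t ht =>
      (hZ t (Set.Ioo_subset_Icc_self ht)).hasDerivAt (Icc_mem_nhds ht.1 ht.2)⟩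
  choose Z hZ0 hZ using hloc
  have hagree : ∀ N N' : ℕ, N ≤ N' → ∀ t ∈ Set.Ioo (-((N : ℝ) + 1)) (N + 1), Z N t = Z N' t := by
    intro N N' hN
    have hN' : (N : ℝ) ≤ N' := Nat.cast_le.2 hN
    refine ODE_solution_unique_of_mem_Ioo (v := fun _ => G) (K := K) (s := fun _ => Set.univ)
      (t₀ := 0) (fun _ _ => hG.lipschitzOnWith)
      ⟨by linarith [N.cast_nonneg (α := ℝ)], by positivity⟩ (fun t ht => ⟨hZ N t ht, trivial⟩)
      (fun t ht => ⟨hZ N' t ⟨by linarith [ht.1], by linarith [ht.2]⟩, trivial⟩) ?_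
    rw [hZ0, hZ0]
  -- Local solutions are glued by the index ⌈|t|⌉. The margin 1 in the intervals leaves a
  -- neighbourhood of t on which the candidates agree.
  refine ⟨fun t => Z ⌈|t|⌉₊ t, by simp [hZ0], fun t => ?_⟩
  have hmem : ∀ s : ℝ, s ∈ Set.Ioo (-((⌈|s|⌉₊ : ℝ) + 1)) (⌈|s|⌉₊ + 1) := fun s =>
    abs_lt.1 (lt_of_le_of_lt (Nat.le_ceil |s|) (lt_add_one _))
  refine (hZ _ t (hmem t)).congr_of_eventuallyEq ?_
  filter_upwards [Ioo_mem_nhds (hmem t).1 (hmem t).2] with s hs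
  rcases le_total ⌈|s|⌉₊ ⌈|t|⌉₊ with h | h
  · exact hagree _ _ h s (hmem s)
  · exact (hagree _ _ h s hs).symm

/-- The law of `w + Z(w)` when `w` has law `μ₀`. -/
noncomputable def displacedLaw (μ₀ : Measure (E d)) (Z : E d →ᵇ E d) : Measure (E d) :=
  μ₀.map fun w => w + Z w

theorem continuous_add_apply (Z : E d →ᵇ E d) : Continuous fun w => w + Z w :=
  continuous_id.add Z.continuous

instance isProbabilityMeasure_displacedLaw (μ₀ : Measure (E d)) [IsProbabilityMeasure μ₀]
    (Z : E d →ᵇ E d) : IsProbabilityMeasure (displacedLaw μ₀ Z) :=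
  Measure.isProbabilityMeasure_map (continuous_add_apply Z).aemeasurable

theorem integral_displacedLaw (μ₀ : Measure (E d)) (Z : E d →ᵇ E d) {f : E d → ℝ}
    (hf : Continuous f) : ∫ w, f w ∂(displacedLaw μ₀ Z) = ∫ w, f (w + Z w) ∂μ₀ :=
  integral_map (continuous_add_apply Z).aemeasurable hf.aestronglyMeasurable

theorem integrable_norm_displacedLaw {μ₀ : Measure (E d)} [IsProbabilityMeasure μ₀]
    (hμ₀ : Integrable (fun w : E d => ‖w‖) μ₀) (Z : E d →ᵇ E d) :
    Integrable (fun w : E d => ‖w‖) (displacedLaw μ₀ Z) := by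
  refine (integrable_map_measure continuous_norm.aestronglyMeasurable
    (continuous_add_apply Z).aemeasurable).2 ?_
  refine Integrable.mono' (hμ₀.add (integrable_const ‖Z‖))
    (continuous_norm.comp (continuous_add_apply Z)).aestronglyMeasurable (ae_of_all _ fun w => ?_)
  simp only [Function.comp_apply, norm_norm]
  exact (norm_add_le _ _).trans (add_le_add_right (Z.norm_coe_le_norm w) _)

/-- The displaced law as an element of `P_1`. -/
noncomputable def displacedP1 {μ₀ : Measure (E d)} [IsProbabilityMeasure μ₀]
    (hμ₀ : Integrable (fun w : E d => ‖w‖) μ₀) (Z : E d →ᵇ E d) : P1 d :=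
  ⟨⟨displacedLaw μ₀ Z, inferInstance⟩, integrable_norm_displacedLaw hμ₀ Z⟩

/-- Both displacements are driven by the same starting point w, which couples the two laws at cost
at most the uniform distance. -/
theorem W1_displacedP1_le {μ₀ : Measure (E d)} [IsProbabilityMeasure μ₀]
    (hμ₀ : Integrable (fun w : E d => ‖w‖) μ₀) (Z Z' : E d →ᵇ E d) :
    W1 (displacedP1 hμ₀ Z) (displacedP1 hμ₀ Z') ≤ edist Z Z' := by
  have hm : Measurable fun w => (w + Z w, w + Z' w) :=
    ((continuous_add_apply Z).prodMk (continuous_add_apply Z')).measurable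
  refine iInf_le_of_le (μ₀.map fun w => (w + Z w, w + Z' w)) (iInf_le_of_le ?_ (iInf_le_of_le ?_ ?_))
  · exact Measure.map_map measurable_fst hm
  · exact Measure.map_map measurable_snd hm
  · rw [lintegral_map (by fun_prop) hm]
    calc ∫⁻ w, edist (w + Z w) (w + Z' w) ∂μ₀ ≤ ∫⁻ _, edist Z Z' ∂μ₀ := by
          refine lintegral_mono fun w => ?_
          rw [edist_add_left, edist_dist, edist_dist]
          exact ENNReal.ofReal_le_ofReal (BoundedContinuousFunction.dist_coe_le_dist w)
      _ = edist Z Z' := by simp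

namespace RegularDrift

variable {b : Measure (E d) → E d → E d} {M : ℝ} {μ₀ : Measure (E d)} [IsProbabilityMeasure μ₀]

/-- The velocity field on displacements of `μ₀` induced by the velocity field `b`. -/
noncomputable def lagrangianField (hb : RegularDrift b M) (μ₀ : Measure (E d))
    [IsProbabilityMeasure μ₀] (Z : E d →ᵇ E d) : E d →ᵇ E d :=
  BoundedContinuousFunction.ofNormedAddCommGroup (fun w => b (displacedLaw μ₀ Z) (w + Z w))
    ((hb.smooth _).1.continuous.comp (continuous_add_apply Z)) M fun _ => hb.norm_le _ _

theorem norm_lagrangianField_le (hb : RegularDrift b M) (Z : E d →ᵇ E d) :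
    ‖hb.lagrangianField μ₀ Z‖ ≤ M :=
  BoundedContinuousFunction.norm_ofNormedAddCommGroup_le _ hb.nonneg _

theorem abs_integral_displacedLaw_sub_le {f : E d → ℝ} {q : ℝ} (hf : DerivBound q f)
    (Z Z' : E d →ᵇ E d) :
    |∫ w, f w ∂(displacedLaw μ₀ Z) - ∫ w, f w ∂(displacedLaw μ₀ Z')| ≤ q * ‖Z - Z'‖ := by
  have hi : ∀ Z : E d →ᵇ E d, Integrable (fun w => f (w + Z w)) μ₀ := fun Z =>
    (hf.smooth.integrable (displacedLaw μ₀ Z)).comp_measurable (continuous_add_apply Z).measurable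
  rw [integral_displacedLaw μ₀ Z hf.smooth.1.continuous,
    integral_displacedLaw μ₀ Z' hf.smooth.1.continuous, ← integral_sub (hi Z) (hi Z')]
  have h := norm_integral_le_of_norm_le_const (μ := μ₀) (C := q * ‖Z - Z'‖)
    (f := fun w => f (w + Z w) - f (w + Z' w)) (ae_of_all _ fun w => by
      refine (hf.abs_sub_le _ _).trans (mul_le_mul_of_nonneg_left ?_ hf.nonneg)
      rw [add_sub_add_left_eq_sub]
      exact (Z - Z').norm_coe_le_norm w)
  simpa using h

theorem lipschitzWith_lagrangianField (hb : RegularDrift b M) :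
    LipschitzWith (2 * M).toNNReal (hb.lagrangianField μ₀) := by
  have hM := hb.nonneg
  refine LipschitzWith.of_dist_le_mul fun Z Z' => ?_
  rw [Real.coe_toNNReal _ (by positivity), dist_eq_norm Z Z',
    BoundedContinuousFunction.dist_le (by positivity)]
  intro w
  rw [dist_eq_norm]
  change ‖b (displacedLaw μ₀ Z) (w + Z w) - b (displacedLaw μ₀ Z') (w + Z' w)‖ ≤ _
  -- The constant 2M splits into M for moving the point under a fixed law and M for changing the
  -- law.
  have h1 := hb.norm_sub_le_mul (displacedLaw μ₀ Z) (w + Z w) (w + Z' w)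
  rw [add_sub_add_left_eq_sub] at h1
  have h2 := hb.norm_sub_le (displacedLaw μ₀ Z) (displacedLaw μ₀ Z') _
    (fun q f hf => abs_integral_displacedLaw_sub_le hf Z Z') (w + Z' w)
  have h3 : M * ‖Z w - Z' w‖ ≤ M * ‖Z - Z'‖ :=
    mul_le_mul_of_nonneg_left ((Z - Z').norm_coe_le_norm w) hM
  have h4 := norm_sub_le_norm_sub_add_norm_sub (b (displacedLaw μ₀ Z) (w + Z w))
    (b (displacedLaw μ₀ Z) (w + Z' w)) (b (displacedLaw μ₀ Z') (w + Z' w))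
  linarith

/-- The chain rule along the characteristics. -/
theorem hasDerivAt_integral_displacedLaw (hb : RegularDrift b M) {Z : ℝ → E d →ᵇ E d}
    (hZ : ∀ t, HasDerivAt Z (hb.lagrangianField μ₀ (Z t)) t) {f : E d → ℝ} (hf : BddSmooth f)
    (t : ℝ) : HasDerivAt (fun s => ∫ w, f w ∂(displacedLaw μ₀ (Z s)))
      (rate b f (displacedLaw μ₀ (Z t))) t := by
  obtain ⟨q, hq⟩ := hf.exists_derivBound
  rw [rate, integral_displacedLaw μ₀ (Z t) (hb.bddSmooth_inner hf _).1.continuous]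
  simp only [integral_displacedLaw μ₀ _ hf.1.continuous]
  refine (hasDerivAt_integral_of_dominated_loc_of_deriv_le (s := Set.univ)
    (bound := fun _ => q * M)
    (F' := fun s w => inner ℝ (gradient f (w + Z s w)) (b (displacedLaw μ₀ (Z s)) (w + Z s w)))
    univ_mem (Eventually.of_forall fun s =>
      (hf.1.continuous.comp (continuous_add_apply (Z s))).aestronglyMeasurable)
    ((hf.integrable (displacedLaw μ₀ (Z t))).comp_measurable
      (continuous_add_apply (Z t)).measurable)
    ((hb.bddSmooth_inner hf _).1.continuous.comp
      (continuous_add_apply (Z t))).aestronglyMeasurable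
    (ae_of_all _ fun w s _ => hb.abs_inner_le hq.norm_le _ _) (integrable_const _)
    (ae_of_all _ fun w s _ => ?_)).2
  -- Evaluation at w is continuous and linear, so the ODE in the Banach space yields the
  -- characteristic ODE at each point.
  have h1 : HasDerivAt (fun s => w + Z s w) (b (displacedLaw μ₀ (Z s)) (w + Z s w)) s :=
    ((BoundedContinuousFunction.evalCLM (β := E d) ℝ w).hasFDerivAt.comp_hasDerivAt (𝕜 := ℝ) s
      (hZ s)).const_add w
  have h2 := (hf.differentiable (w + Z s w)).hasFDerivAt.comp_hasDerivAt s h1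
  rw [inner_gradient_left]
  exact h2

/-- Existence of weak solutions of the continuity equation. -/
theorem exists_weakSolution (hb : RegularDrift b M)
    (hμ₀ : Integrable (fun w : E d => ‖w‖) μ₀) :
    ∃ μ : ℝ≥0 → P1 d, IsW1Continuous μ ∧ IsWeakSolution b μ₀ μ := by
  obtain ⟨Z, hZ0, hZ⟩ := exists_global_integralCurve (M := ⟨M, hb.nonneg⟩)
    (hb.lipschitzWith_lagrangianField (μ₀ := μ₀)) hb.norm_lagrangianField_le 0
  have hZc : Continuous Z := continuous_iff_continuousAt.2 fun t => (hZ t).continuousAt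
  have hW : IsW1Continuous fun t : ℝ≥0 => displacedP1 hμ₀ (Z t) := fun t₀ => by
    refine tendsto_of_tendsto_of_tendsto_of_le_of_le tendsto_const_nhds
      (h := fun t : ℝ≥0 => edist (Z t) (Z t₀)) ?_ (fun _ => zero_le)
      (fun t => W1_displacedP1_le hμ₀ (Z t) (Z t₀))
    exact tendsto_iff_edist_tendsto_0.1 ((hZc.comp NNReal.continuous_coe).tendsto t₀)
  refine ⟨fun t => displacedP1 hμ₀ (Z t), hW, fun f hf t => ?_⟩
  have hint := intervalIntegral.integral_eq_sub_of_hasDerivAt (a := 0) (b := (t : ℝ))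
    (f := fun s => ∫ w, f w ∂(displacedLaw μ₀ (Z s)))
    -- With `toNNReal` this is the function whose continuity is known; on [0, t] it coincides with
    -- the true derivative.
    (f' := fun s => rate b f (displacedP1 hμ₀ (Z s.toNNReal)).toMeasure)
    (fun s hs => by
      rw [Set.uIcc_of_le t.coe_nonneg] at hs
      simp only [Real.coe_toNNReal s hs.1]
      exact hb.hasDerivAt_integral_displacedLaw hZ hf s)
    ((hb.continuous_rate hW hf).intervalIntegrable _ _)
  have h0 : ∫ w, f w ∂(displacedLaw μ₀ (Z 0)) = ∫ w, f w ∂μ₀ := by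
    rw [integral_displacedLaw μ₀ _ hf.1.continuous, hZ0]
    simp
  rw [h0] at hint
  exact (eq_add_of_sub_eq' hint.symm)

end RegularDrift

/-! ### Reduction of the limit equation and conclusion -/

theorem SmoothKernel.solvesLimitEquation_iff {d n : ℕ} {𝒳 : Set (E n)} {𝒴 : Set ℝ} {α : ℝ}
    {σ : E d → 𝒳 → ℝ} (hσ : SmoothKernel σ) {π : Measure (𝒳 × 𝒴)} [IsProbabilityMeasure π]
    (hy : Integrable (fun z : 𝒳 × 𝒴 => (z.2 : ℝ)) π) {μ₀ : Measure (E d)} {μ : ℝ≥0 → P1 d} :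
    SolvesLimitEquation α σ π μ₀ μ ↔ IsWeakSolution (meanFieldDrift π α σ) μ₀ μ := by
  refine forall_congr' fun f => forall_congr' fun hf => forall_congr' fun t => ?_
  have h : ∀ s : ℝ, _ := fun s => hσ.integral_inner_gradient_potential
    (hσ.integrable_dataWeight (ρ := (μ s.toNNReal).toMeasure) hy α) (μ s.toNNReal).toMeasure hf
  simp only [meanFieldDrift, ← h, dataWeight]

/-- Holds because |g| ≤ 1 + |g| ^ k; it turns the moment assumptions into the first moments on which
the construction runs. -/
theorem integrable_of_integrable_pow {Ω : Type*} [MeasurableSpace Ω] {m : Measure Ω}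
    [IsFiniteMeasure m] {g : Ω → ℝ} (hg : AEStronglyMeasurable g m) {k : ℕ} (hk : k ≠ 0)
    (h : Integrable (fun z => |g z| ^ k) m) : Integrable g m := by
  refine Integrable.mono' ((integrable_const 1).add h) hg (ae_of_all _ fun z => ?_)
  rw [Real.norm_eq_abs, Pi.add_apply]
  rcases le_total |g z| 1 with h1 | h1
  · exact h1.trans (le_add_of_nonneg_right (by positivity))
  · exact (le_self_pow₀ h1 hk).trans (le_add_of_nonneg_left zero_le_one)

end MeanField

theorem mainTheorem4 (d n : ℕ) (hd : 1 ≤ d) (hn : 1 ≤ n)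
    (𝒳 : Set (MeanField.E n)) (𝒴 : Set ℝ) (α : ℝ)
    (σ : MeanField.E d → 𝒳 → ℝ) (hσ : MeanField.IsCbInftyOn σ)
    (π : Measure (𝒳 × 𝒴)) [IsProbabilityMeasure π]
    (hπ : Integrable (fun z : 𝒳 × 𝒴 => |(z.2 : ℝ)| ^ (16 * MeanField.gammaStar d)) π)
    (μ₀ : Measure (MeanField.E d)) [IsProbabilityMeasure μ₀]
    (hμ₀ : Integrable (fun w : MeanField.E d => ‖w‖ ^ (8 * MeanField.gammaStar d)) μ₀) :
    ∃! μ : ℝ≥0 → MeanField.P1 d,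
      MeanField.IsW1Continuous μ ∧ MeanField.SolvesLimitEquation α σ π μ₀ μ := by
  have hK := hσ.smoothKernel
  have hy : Integrable (fun z : 𝒳 × 𝒴 => (z.2 : ℝ)) π :=
    MeanField.integrable_of_integrable_pow
      (by fun_prop : Measurable fun z : 𝒳 × 𝒴 => (z.2 : ℝ)).aestronglyMeasurable
      (by simp [MeanField.gammaStar]) hπ
  have hw : Integrable (fun w : MeanField.E d => ‖w‖) μ₀ :=
    MeanField.integrable_of_integrable_pow continuous_norm.aestronglyMeasurable
      (k := 8 * MeanField.gammaStar d) (by simp [MeanField.gammaStar])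
      (by simpa only [abs_norm] using hμ₀)
  obtain ⟨M, hb⟩ := hK.exists_regularDrift hy α
  obtain ⟨μ, hc, hs⟩ := hb.exists_weakSolution hw
  refine ⟨μ, ⟨hc, (hK.solvesLimitEquation_iff hy).2 hs⟩, fun ν hν => ?_⟩
  exact hb.weakSolution_unique hν.1 ((hK.solvesLimitEquation_iff hy).1 hν.2) hc hs
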